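/- Let $E$ be a complex Banach lattice, i.e. the complexification $E=X\oplus iX$ of a real Banach lattice $X$, with norm $\|z\|=\||z|\|$, where $|z|=\sup_{\theta\in\mathbb{R}}\operatorname{Re}(e^{i\theta}z)$, and with positive cone $E_+=X_+$. We write $f\ge 0$ for $f\in E_+$, and call a linear operator $P:E\to E$ positive if $P(E_+)\subseteq E_+$. Let $(e^{tA})_{t\ge 0}$ be a $C_0$-semigroup on $E$ with generator $A$, and let $(P_n)_{n\in\mathbb{N}}$ be an increasing sequence of positive linear operators on $E$ (i.e. $P_{n+1}-P_n$ is positive for every $n$) converging strongly to the identity. Assume that the semigroup has the LEP property (local eventual positivity) with respect to $(P_n)_{n\in\mathbb{N}}$: for every $n\in\mathbb{N}$ and every $f\in E_+\setminus\{0\}$ there exists $\tau>0$ (depending on $n$ and $f$) such that $$P_n e^{tA}f\ge 0\qquad\text{for all } t\ge\tau.$$ Let $\sigma(A)$ be the spectrum of $A$, let $\sigma_{\mathrm{ess}}(A)$ be the set of all $\lambda\in\mathbb{C}$ for which $\ker(A-\lambda I)$ or $E/\operatorname{rg}(A-\lambda I)$ is infinite-dimensional, and put $$s(A)=\sup\{\operatorname{Re}\lambda:\lambda\in\sigma(A)\},\qquad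 s_{\mathrm{ess}}(A)=\sup\{\operatorname{Re}\lambda:\lambda\in\sigma_{\mathrm{ess}}(A)\}$$ in $[-\infty,\infty]$, with $\sup\emptyset=-\infty$. If $s_{\mathrm{ess}}(A)<s(A)$, then $s(A)$ is a real number and $s(A)\in\sigma(A)$. -/

import Mathlib

open Filter Topology
open scoped NNReal

noncomputable section

/-! ### Complex Banach lattices

A real Banach lattice is a complete normed space `X` over `ℝ` with a lattice order that is compatible
with addition and with multiplication by non-negative scalars and with a solid (lattice) norm:
`[NormedAddCommGroup X] [NormedSpace ℝ X] [CompleteSpace X] [Lattice X] [IsOrderedAddMonoid X]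
[IsOrderedModule ℝ X] [HasSolidNorm X]`.

A complex Banach lattice is the complexification of a real Banach lattice `X`, with the norm
`‖z‖ = ‖|z|‖`, where `|z| = sup {Re (w z) : w ∈ ℂ, |w| = 1}` is the modulus of `z`. -/

/-- The complexification `X + i X` of a real vector space `X`. -/
@[ext]
structure Complexification (X : Type*) where
  re : X
  im : X

namespace Complexification

section Algebra

variable {X : Type*} [AddCommGroup X]

instance : Zero (Complexification X) := ⟨⟨0, 0⟩⟩
instance : Add (Complexification X) := ⟨fun z w => ⟨z.re + w.re, z.im + w.im⟩⟩
instance : Neg (Complexification X) := ⟨fun z => ⟨-z.re, -z.im⟩⟩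
instance : Sub (Complexification X) := ⟨fun z w => ⟨z.re - w.re, z.im - w.im⟩⟩

@[simp] theorem zero_re : (0 : Complexification X).re = 0 := rfl
@[simp] theorem zero_im : (0 : Complexification X).im = 0 := rfl
@[simp] theorem add_re (z w : Complexification X) : (z + w).re = z.re + w.re := rfl
@[simp] theorem add_im (z w : Complexification X) : (z + w).im = z.im + w.im := rfl
@[simp] theorem neg_re (z : Complexification X) : (-z).re = -z.re := rfl
@[simp] theorem neg_im (z : Complexification X) : (-z).im = -z.im := rfl
@[simp] theorem sub_re (z w : Complexification X) : (z - w).re = z.re - w.re := rfl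
@[simp] theorem sub_im (z w : Complexification X) : (z - w).im = z.im - w.im := rfl

instance : AddCommGroup (Complexification X) where
  add_assoc a b c := by ext <;> simp [add_assoc]
  zero_add a := by ext <;> simp
  add_zero a := by ext <;> simp
  nsmul := nsmulRec
  zsmul := zsmulRec
  neg_add_cancel a := by ext <;> simp
  sub_eq_add_neg a b := by ext <;> simp [sub_eq_add_neg]
  add_comm a b := by ext <;> simp [add_comm]

variable [Module ℝ X]

instance : SMul ℂ (Complexification X) :=
  ⟨fun c z => ⟨c.re • z.re - c.im • z.im, c.re • z.im + c.im • z.re⟩⟩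

@[simp] theorem smul_re (c : ℂ) (z : Complexification X) :
    (c • z).re = c.re • z.re - c.im • z.im := rfl
@[simp] theorem smul_im (c : ℂ) (z : Complexification X) :
    (c • z).im = c.re • z.im + c.im • z.re := rfl

instance : Module ℂ (Complexification X) where
  one_smul z := by ext <;> simp
  mul_smul a b z := by
    ext
    · simp only [smul_re, smul_im, Complex.mul_re, Complex.mul_im]; module
    · simp only [smul_re, smul_im, Complex.mul_re, Complex.mul_im]; module
  smul_zero a := by ext <;> simp
  smul_add a z w := by
    ext
    · simp only [smul_re, add_re, add_im]; module
    · simp only [smul_im, add_re, add_im]; module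
  add_smul a b z := by
    ext
    · simp only [smul_re, add_re, Complex.add_re, Complex.add_im]; module
    · simp only [smul_im, add_im, Complex.add_re, Complex.add_im]; module
  zero_smul z := by ext <;> simp

end Algebra

section Order

theorem norm_le_norm_of_le {X : Type*} [NormedAddCommGroup X] [Lattice X] [IsOrderedAddMonoid X]
    [HasSolidNorm X] {x y : X} (hx : 0 ≤ x) (h : x ≤ y) : ‖x‖ ≤ ‖y‖ :=
  norm_le_norm_of_abs_le_abs (by rwa [abs_of_nonneg hx, abs_of_nonneg (hx.trans h)])

theorem smul_le_abs_smul_abs {X : Type*} [AddCommGroup X] [Module ℝ X] [Lattice X]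
    [IsOrderedModule ℝ X] (c : ℝ) (x : X) : c • x ≤ |c| • |x| := by
  rcases le_total 0 c with hc | hc
  · rw [abs_of_nonneg hc]
    exact smul_le_smul_of_nonneg_left (le_abs_self x) hc
  · rw [abs_of_nonpos hc]
    have := smul_le_smul_of_nonneg_left (neg_le_abs x) (neg_nonneg.2 hc)
    simpa using this

end Order

section Lattice

variable {X : Type*} [NormedAddCommGroup X] [NormedSpace ℝ X] [Lattice X]
  [IsOrderedAddMonoid X] [IsOrderedModule ℝ X]

theorem smul_re_le (c : ℂ) (z : Complexification X) :
    (c • z).re ≤ ‖c‖ • (|z.re| + |z.im|) := by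
  have h1 := smul_le_abs_smul_abs c.re z.re
  have h2 := smul_le_abs_smul_abs (-c.im) z.im
  rw [abs_neg, neg_smul] at h2
  have h3 : |c.re| • |z.re| ≤ ‖c‖ • |z.re| :=
    smul_le_smul_of_nonneg_right (Complex.abs_re_le_norm c) (abs_nonneg _)
  have h4 : |c.im| • |z.im| ≤ ‖c‖ • |z.im| :=
    smul_le_smul_of_nonneg_right (Complex.abs_im_le_norm c) (abs_nonneg _)
  rw [smul_re, smul_add, sub_eq_add_neg]
  exact add_le_add (h1.trans h3) (h2.trans h4)

variable [HasSolidNorm X] [CompleteSpace X]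

/-- In a Banach lattice the supremum defining the modulus exists. -/
theorem exists_modulus (z : Complexification X) :
    ∃ m : X, IsLUB {x : X | ∃ w : ℂ, ‖w‖ = 1 ∧ x = (w • z).re} m := by
  set u : X := |z.re| + |z.im| with hu
  have hu0 : 0 ≤ u := add_nonneg (abs_nonneg _) (abs_nonneg _)
  set S : Set X := {x : X | ∃ w : ℂ, ‖w‖ = 1 ∧ x = (w • z).re} with hS
  have key : ∀ n : ℕ, ∃ a : X, (∀ x ∈ S, x ≤ a + (1 / ((n : ℝ) + 1)) • u) ∧
      ∀ b ∈ upperBounds S, a ≤ b := by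
    intro n
    have hε : (0 : ℝ) < 1 / ((n : ℝ) + 1) := by positivity
    obtain ⟨t, htS, htf, htc⟩ :=
      Metric.finite_approx_of_totallyBounded (isCompact_sphere (0 : ℂ) 1).totallyBounded _ hε
    have hne : htf.toFinset.Nonempty := by
      have h1 := htc (show (1 : ℂ) ∈ Metric.sphere (0 : ℂ) 1 by simp)
      simp only [Set.mem_iUnion] at h1
      obtain ⟨y, hy, -⟩ := h1
      exact ⟨y, by simpa using hy⟩
    refine ⟨htf.toFinset.sup' hne fun w => (w • z).re, ?_, ?_⟩
    · rintro x ⟨w, hw, rfl⟩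
      have h1 := htc (show w ∈ Metric.sphere (0 : ℂ) 1 by simpa using hw)
      simp only [Set.mem_iUnion] at h1
      obtain ⟨y, hy, hwy⟩ := h1
      have h2 : (w • z).re = (y • z).re + ((w - y) • z).re := by
        rw [← add_re, ← add_smul]; congr 2; ring
      have h3 : ‖w - y‖ ≤ 1 / ((n : ℝ) + 1) := by
        rw [← dist_eq_norm]; exact (Metric.mem_ball.1 hwy).le
      rw [h2]
      exact add_le_add
        (Finset.le_sup' (fun w : ℂ => (w • z).re) (by simpa using hy))
        ((smul_re_le _ _).trans (smul_le_smul_of_nonneg_right h3 hu0))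
    · intro b hb
      refine Finset.sup'_le hne _ fun w hw => hb ⟨w, ?_, rfl⟩
      simpa using htS (by simpa using hw)
  choose a ha1 ha2 using key
  have hle : ∀ m n, a m - a n ≤ (1 / ((n : ℝ) + 1)) • u := fun m n =>
    sub_le_iff_le_add'.2 (ha2 m _ fun x hx => ha1 n x hx)
  have hdist : ∀ N m n : ℕ, N ≤ m → N ≤ n → dist (a m) (a n) ≤ 1 / ((N : ℝ) + 1) * ‖u‖ := by
    intro N m n hm hn
    have hmono : ∀ k : ℕ, N ≤ k → (1 / ((k : ℝ) + 1)) • u ≤ (1 / ((N : ℝ) + 1)) • u := by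
      intro k hk
      refine smul_le_smul_of_nonneg_right ?_ hu0
      exact Nat.one_div_le_one_div hk
    have h0 : 0 ≤ (1 / ((N : ℝ) + 1)) • u := smul_nonneg (by positivity) hu0
    have h1 : |a m - a n| ≤ |(1 / ((N : ℝ) + 1)) • u| := by
      rw [abs_of_nonneg h0]
      refine abs_le'.2 ⟨(hle m n).trans (hmono n hn), ?_⟩
      rw [neg_sub]
      exact (hle n m).trans (hmono m hm)
    rw [dist_eq_norm]
    refine (norm_le_norm_of_abs_le_abs h1).trans ?_
    rw [norm_smul, Real.norm_of_nonneg (by positivity)]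
  have hlim : Tendsto (fun N : ℕ => 1 / ((N : ℝ) + 1)) atTop (𝓝 0) :=
    tendsto_one_div_add_atTop_nhds_zero_nat
  have hcau : CauchySeq a := by
    refine cauchySeq_of_le_tendsto_0 (fun N : ℕ => 1 / ((N : ℝ) + 1) * ‖u‖)
      (fun n m N hn hm => hdist N n m hn hm) ?_
    simpa using hlim.mul_const ‖u‖
  obtain ⟨l, hl⟩ := cauchySeq_tendsto_of_complete hcau
  refine ⟨l, fun x hx => ?_, fun b hb => le_of_tendsto' hl fun n => ha2 n b hb⟩
  have h1 : Tendsto (fun n : ℕ => a n + (1 / ((n : ℝ) + 1)) • u) atTop (𝓝 (l + (0 : ℝ) • u)) :=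
    hl.add (hlim.smul_const u)
  rw [zero_smul, add_zero] at h1
  exact ge_of_tendsto' h1 fun n => ha1 n x hx

/-- The modulus `|z| = sup {Re (w z) : w ∈ ℂ, |w| = 1}`, an element of the real Banach lattice. -/
def modulus (z : Complexification X) : X := Classical.choose (exists_modulus z)

theorem isLUB_modulus (z : Complexification X) :
    IsLUB {x : X | ∃ w : ℂ, ‖w‖ = 1 ∧ x = (w • z).re} z.modulus :=
  Classical.choose_spec (exists_modulus z)

theorem smul_re_le_modulus (z : Complexification X) {w : ℂ} (hw : ‖w‖ = 1) :
    (w • z).re ≤ z.modulus := (isLUB_modulus z).1 ⟨w, hw, rfl⟩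

theorem modulus_le {z : Complexification X} {b : X} (h : ∀ w : ℂ, ‖w‖ = 1 → (w • z).re ≤ b) :
    z.modulus ≤ b := (isLUB_modulus z).2 (by rintro x ⟨w, hw, rfl⟩; exact h w hw)

theorem abs_re_le_modulus (z : Complexification X) : |z.re| ≤ z.modulus := by
  refine abs_le'.2 ⟨?_, ?_⟩
  · simpa using smul_re_le_modulus z (w := 1) (by simp)
  · simpa using smul_re_le_modulus z (w := -1) (by simp)

theorem abs_im_le_modulus (z : Complexification X) : |z.im| ≤ z.modulus := by
  refine abs_le'.2 ⟨?_, ?_⟩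
  · simpa using smul_re_le_modulus z (w := -Complex.I) (by simp)
  · simpa using smul_re_le_modulus z (w := Complex.I) (by simp)

theorem modulus_nonneg (z : Complexification X) : 0 ≤ z.modulus :=
  (abs_nonneg _).trans (abs_re_le_modulus z)

theorem modulus_le_add (z : Complexification X) : z.modulus ≤ |z.re| + |z.im| :=
  modulus_le fun w hw => by simpa [hw] using smul_re_le w z

theorem modulus_add_le (z w : Complexification X) : (z + w).modulus ≤ z.modulus + w.modulus :=
  modulus_le fun c hc => by
    rw [smul_add, add_re]
    exact add_le_add (smul_re_le_modulus z hc) (smul_re_le_modulus w hc)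

theorem modulus_smul_le (c : ℂ) (z : Complexification X) : (c • z).modulus ≤ ‖c‖ • z.modulus := by
  refine modulus_le fun w hw => ?_
  rcases eq_or_ne c 0 with rfl | hc
  · simp
  have hc' : (‖c‖ : ℂ) ≠ 0 := by simpa using hc
  have h1 : w • c • z = (‖c‖ : ℂ) • (w * c / ‖c‖) • z := by
    rw [smul_smul, smul_smul]; congr 1; field_simp
  have h2 : ‖w * c / ‖c‖‖ = 1 := by
    have : ‖c‖ ≠ 0 := by simpa using hc
    simp [hw, this]
  have h3 := smul_le_smul_of_nonneg_left (smul_re_le_modulus z h2) (norm_nonneg c)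
  rw [h1, smul_re]
  simpa using h3

instance : Norm (Complexification X) := ⟨fun z => ‖z.modulus‖⟩

theorem norm_def (z : Complexification X) : ‖z‖ = ‖z.modulus‖ := rfl

theorem norm_re_le (z : Complexification X) : ‖z.re‖ ≤ ‖z‖ := by
  rw [norm_def, ← norm_abs_eq_norm z.re]
  exact norm_le_norm_of_le (abs_nonneg _) (abs_re_le_modulus z)

theorem norm_im_le (z : Complexification X) : ‖z.im‖ ≤ ‖z‖ := by
  rw [norm_def, ← norm_abs_eq_norm z.im]
  exact norm_le_norm_of_le (abs_nonneg _) (abs_im_le_modulus z)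

theorem norm_le_add (z : Complexification X) : ‖z‖ ≤ ‖z.re‖ + ‖z.im‖ := by
  rw [norm_def, ← norm_abs_eq_norm z.re, ← norm_abs_eq_norm z.im]
  exact (norm_le_norm_of_le (modulus_nonneg z) (modulus_le_add z)).trans (norm_add_le _ _)

theorem normedSpaceCore : NormedSpace.Core ℂ (Complexification X) where
  norm_nonneg z := norm_nonneg z.modulus
  norm_smul c z := by
    have hle : ∀ (c : ℂ) (z : Complexification X), ‖c • z‖ ≤ ‖c‖ * ‖z‖ := fun c z => by
      have := norm_le_norm_of_le (modulus_nonneg _) (modulus_smul_le c z)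
      rwa [norm_smul, norm_norm] at this
    refine le_antisymm (hle c z) ?_
    rcases eq_or_ne c 0 with rfl | hc
    · rw [norm_zero, zero_mul]
      exact norm_nonneg (modulus ((0 : ℂ) • z))
    have h := hle c⁻¹ (c • z)
    rw [inv_smul_smul₀ hc, norm_inv] at h
    have hc' : 0 < ‖c‖ := norm_pos_iff.2 hc
    rwa [inv_mul_eq_div, le_div_iff₀' hc'] at h
  norm_triangle z w :=
    (norm_le_norm_of_le (modulus_nonneg _) (modulus_add_le z w)).trans (norm_add_le _ _)
  norm_eq_zero_iff z := by
    refine ⟨fun h => ?_, fun h => ?_⟩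
    · have h1 := norm_re_le z
      have h2 := norm_im_le z
      rw [h] at h1 h2
      exact Complexification.ext (norm_le_zero_iff.1 h1) (norm_le_zero_iff.1 h2)
    · subst h
      have h1 := norm_le_add (0 : Complexification X)
      simp only [zero_re, zero_im, norm_zero, add_zero] at h1
      exact le_antisymm h1 (norm_nonneg (modulus (0 : Complexification X)))

instance : NormedAddCommGroup (Complexification X) := NormedAddCommGroup.ofCore normedSpaceCore

instance : NormedSpace ℂ (Complexification X) := NormedSpace.ofCore normedSpaceCore

theorem exists_tendsto_of_cauchySeq (f : ℕ → Complexification X) (hf : CauchySeq f) :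
    ∃ a, Tendsto f atTop (𝓝 a) := by
  have hre : CauchySeq fun n => (f n).re := by
    refine Metric.cauchySeq_iff'.2 fun ε hε => ?_
    obtain ⟨N, hN⟩ := Metric.cauchySeq_iff'.1 hf ε hε
    refine ⟨N, fun n hn => ?_⟩
    have h := hN n hn
    rw [dist_eq_norm] at h ⊢
    exact (norm_re_le (f n - f N)).trans_lt h
  have him : CauchySeq fun n => (f n).im := by
    refine Metric.cauchySeq_iff'.2 fun ε hε => ?_
    obtain ⟨N, hN⟩ := Metric.cauchySeq_iff'.1 hf ε hε
    refine ⟨N, fun n hn => ?_⟩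
    have h := hN n hn
    rw [dist_eq_norm] at h ⊢
    exact (norm_im_le (f n - f N)).trans_lt h
  obtain ⟨x, hx⟩ := cauchySeq_tendsto_of_complete hre
  obtain ⟨y, hy⟩ := cauchySeq_tendsto_of_complete him
  have h0 : Tendsto (fun n => ‖(f n).re - x‖ + ‖(f n).im - y‖) atTop (𝓝 0) := by
    simpa using
      (tendsto_iff_norm_sub_tendsto_zero.1 hx).add (tendsto_iff_norm_sub_tendsto_zero.1 hy)
  refine ⟨Complexification.mk x y, tendsto_iff_norm_sub_tendsto_zero.2 ?_⟩
  exact squeeze_zero (fun n => norm_nonneg (f n - Complexification.mk x y))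
    (fun n => norm_le_add (f n - Complexification.mk x y)) h0

instance : CompleteSpace (Complexification X) :=
  Metric.complete_of_cauchySeq_tendsto exists_tendsto_of_cauchySeq

end Lattice

section Positivity

variable {X : Type*} [AddCommGroup X] [Lattice X]

/-- The positive cone `E₊` of the complexification `E` of `X`: the elements `x + i 0` with `x ≥ 0`. -/
def positiveCone (X : Type*) [AddCommGroup X] [Lattice X] : Set (Complexification X) :=
  {z | 0 ≤ z.re ∧ z.im = 0}

variable [Module ℝ X]

/-- A linear operator is positive if it maps the positive cone into itself. -/
def IsPositiveOperator (T : Complexification X →ₗ[ℂ] Complexification X) : Prop :=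
  ∀ f ∈ positiveCone X, T f ∈ positiveCone X

end Positivity

end Complexification

/-! ### `C₀`-semigroups and their generators -/

/-- A `C₀`-semigroup of bounded linear operators on a complex normed space. -/
structure C0Semigroup (E : Type*) [NormedAddCommGroup E] [NormedSpace ℂ E] where
  /-- the operator at time `t ≥ 0` -/
  op : ℝ≥0 → E →L[ℂ] E
  op_zero : op 0 = ContinuousLinearMap.id ℂ E
  op_add : ∀ s t, op (s + t) = (op s).comp (op t)
  continuous_orbit : ∀ f, Continuous fun t => op t f

namespace C0Semigroup

variable {E : Type*} [NormedAddCommGroup E] [NormedSpace ℂ E] (T : C0Semigroup E)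

/-- `g = lim_{h ↓ 0} (T(h) f - f) / h`. -/
def HasGeneratorAt (f g : E) : Prop :=
  Tendsto (fun h : ℝ≥0 => ((h : ℝ) : ℂ)⁻¹ • (T.op h f - f)) (𝓝[>] 0) (𝓝 g)

/-- The generator: `D(A)` consists of all `f` for which `lim_{h ↓ 0} (T(h) f - f) / h` exists, and
`A f` is this limit. -/
def generator : E →ₗ.[ℂ] E where
  domain :=
    { carrier := {f | ∃ g, T.HasGeneratorAt f g}
      zero_mem' := ⟨0, by simp [HasGeneratorAt]⟩
      add_mem' := by
        rintro a b ⟨g, hg⟩ ⟨k, hk⟩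
        refine ⟨g + k, (Tendsto.add hg hk).congr fun h => ?_⟩
        rw [map_add]; module
      smul_mem' := by
        rintro c a ⟨g, hg⟩
        refine ⟨c • g, (Tendsto.const_smul hg c).congr fun h => ?_⟩
        rw [map_smul]; module }
  toFun :=
    { toFun := fun f => Classical.choose f.2
      map_add' := fun a b => by
        refine tendsto_nhds_unique (Classical.choose_spec (a + b).2)
          ((Tendsto.add (Classical.choose_spec a.2) (Classical.choose_spec b.2)).congr fun h => ?_)
        rw [Submodule.coe_add, map_add]; module
      map_smul' := fun c a => by
        refine tendsto_nhds_unique (Classical.choose_spec (c • a).2)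
          ((Tendsto.const_smul (Classical.choose_spec a.2) c).congr fun h => ?_)
        rw [Submodule.coe_smul, map_smul]; module }

theorem hasGeneratorAt_generator (f : T.generator.domain) :
    T.HasGeneratorAt f (T.generator f) := Classical.choose_spec f.2

end C0Semigroup

/-! ### Spectrum and essential spectrum of unbounded operators -/

namespace LinearPMap

variable {E : Type*} [NormedAddCommGroup E] [NormedSpace ℂ E] (A : E →ₗ.[ℂ] E)

/-- The set of all `μ` for which `μ - A : D(A) → E` is bijective with a bounded inverse `R`. -/
def resolventSet : Set ℂ :=
  {μ | ∃ R : E →L[ℂ] E,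
    (∀ f : E, ∃ h : R f ∈ A.domain, μ • R f - A ⟨R f, h⟩ = f) ∧
    ∀ f : A.domain, R (μ • (f : E) - A f) = f}

/-- The spectrum `σ(A)`. -/
def spectrum : Set ℂ := (A.resolventSet)ᶜ

/-- The operator `A - μ` with domain `D(A)`. -/
def subScalar (μ : ℂ) : A.domain →ₗ[ℂ] E := A.toFun - μ • A.domain.subtype

/-- The Fredholm domain: all `μ` for which the kernel and the cokernel of `A - μ` are
finite-dimensional. -/
def fredholmDomain : Set ℂ :=
  {μ | FiniteDimensional ℂ (LinearMap.ker (A.subScalar μ)) ∧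
    FiniteDimensional ℂ (E ⧸ LinearMap.range (A.subScalar μ))}

/-- The essential spectrum `σ_ess(A)`. -/
def essentialSpectrum : Set ℂ := (A.fredholmDomain)ᶜ

/-- The spectral bound `s(A) ∈ [-∞, ∞]`, equal to `-∞` if the spectrum is empty. -/
def spectralBound : EReal := sSup ((fun μ : ℂ => (μ.re : EReal)) '' A.spectrum)

/-- The essential spectral bound `s_ess(A) ∈ [-∞, ∞]`. -/
def essentialSpectralBound : EReal := sSup ((fun μ : ℂ => (μ.re : EReal)) '' A.essentialSpectrum)

end LinearPMap

/-! ### Local eventual positivity -/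

/-- `T` has the LEP property with respect to `(P n)`: the `P n` are positive operators, increasing in
`n` and converging strongly to the identity, and for all `n` and `0 ≠ f ∈ E₊` there is `τ > 0` such
that `P n (T(t) f) ∈ E₊` for all `t ≥ τ`. -/
structure HasLEP {X : Type*} [NormedAddCommGroup X] [NormedSpace ℝ X] [CompleteSpace X]
    [Lattice X] [IsOrderedAddMonoid X] [IsOrderedModule ℝ X] [HasSolidNorm X]
    (T : C0Semigroup (Complexification X))
    (P : ℕ → Complexification X →ₗ[ℂ] Complexification X) : Prop where
  positive : ∀ n, Complexification.IsPositiveOperator (P n)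
  increasing : ∀ n, Complexification.IsPositiveOperator (P (n + 1) - P n)
  tendsto_id : ∀ f, Tendsto (fun n => P n f) atTop (𝓝 f)
  eventually_positive : ∀ n, ∀ f ∈ Complexification.positiveCone X, f ≠ 0 →
    ∃ τ : ℝ≥0, 0 < τ ∧ ∀ t, τ ≤ t → P n (T.op t f) ∈ Complexification.positiveCone X

end

/-!
Suppose that `s = s(A)` is not in the spectrum. Then there is `c ∈ (s_ess(A), s)` such that the
whole ray `(c, ∞)` lies in the resolvent set. For `f` in the positive cone, a positive functional
`φ` and `ℓ = φ ∘ P n`, the function `t ↦ ℓ (T(t) f)` is eventually non-negative, and its Laplace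
transform is `ℓ ((z - A)⁻¹ f)`, which is holomorphic near `(c, ∞)`. By the Pringsheim–Landau theorem
the Laplace integral converges on `{Re z > c}` and extends `ℓ ((z - A)⁻¹ f)` holomorphically to that
half-plane; as the cone spans `E`, the same holds for every `f`. At a boundary point `μ` of the
resolvent set inside the half-plane, `A - μ` is Fredholm, and it is injective because an eigenvector
would give some `ℓ ((z - A)⁻¹ f)` a pole at `μ`; being a limit of resolvent points, `μ` itself then
belongs to the resolvent set. Hence the connected set `{Re z > c}` is contained in the resolvent
set, which contradicts `c < s`.
-/

section Landau

open MeasureTheory ProbabilityTheory Set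

variable {Ω : Type*} [MeasurableSpace Ω] {μ : Measure Ω} {X : Ω → ℝ} {x y : ℝ}

theorem eventuallyEq_of_analyticOnNhd_of_isPreconnected {f g : ℂ → ℂ} {U : Set ℂ}
    (hU : IsPreconnected U) (hf : AnalyticOnNhd ℂ f U) (hg : AnalyticOnNhd ℂ g U) {z w : ℂ}
    (hz : z ∈ U) (hw : w ∈ U) (hfg : f =ᶠ[𝓝 z] g) : f =ᶠ[𝓝 w] g := by
  have hsub : U ⊆ {v | f =ᶠ[𝓝 v] g} := by
    refine hU.subset_of_closure_inter_subset isOpen_setOfPred_eventually_nhds ⟨z, hz, hfg⟩ ?_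
    rintro v ⟨hv, hvU⟩
    by_cases hev : f =ᶠ[𝓝 v] g
    · exact hev
    refine ((hf v hvU).frequently_eq_iff_eventually_eq (hg v hvU)).1
      (frequently_nhdsWithin_iff.2 ((mem_closure_iff_frequently.1 hv).mono fun v' hv' => ?_))
    exact ⟨hv'.self_of_nhds, fun h => hev (h ▸ hv')⟩
  exact hsub hw

theorem mem_integrableExpSet_of_nonpos (hX : X ≤ᵐ[μ] 0) (hXm : AEMeasurable X μ)
    (hx : x ∈ integrableExpSet X μ) (hxy : x ≤ y) : y ∈ integrableExpSet X μ := by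
  refine Integrable.mono' hx (by fun_prop) ?_
  filter_upwards [hX] with ω hω
  rw [Real.norm_of_nonneg (Real.exp_pos _).le]
  exact Real.exp_le_exp.2 (mul_le_mul_of_nonpos_right hxy hω)

theorem hasSum_pow_mul_exp (x y v : ℝ) :
    HasSum (fun k : ℕ => (k.factorial : ℝ)⁻¹ * ((y - x) ^ k * (v ^ k * Real.exp (x * v))))
      (Real.exp (y * v)) := by
  have h := (NormedSpace.expSeries_div_hasSum_exp ((y - x) * v)).mul_right (Real.exp (x * v))
  rw [← Real.exp_eq_exp_ℝ, ← Real.exp_add, show (y - x) * v + x * v = y * v by ring] at h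
  refine h.congr_fun fun k => ?_
  rw [mul_pow]
  ring

theorem mem_integrableExpSet_of_summable (hX : X ≤ᵐ[μ] 0)
    (hx : x ∈ interior (integrableExpSet X μ)) (hyx : y ≤ x)
    (hsum : Summable fun k : ℕ =>
      (k.factorial : ℝ)⁻¹ * ((y - x) ^ k * ∫ ω, X ω ^ k * Real.exp (x * X ω) ∂μ)) :
    y ∈ integrableExpSet X μ := by
  have hXm : AEMeasurable X μ := aemeasurable_of_mem_interior_integrableExpSet hx
  set term : ℕ → Ω → ℝ := fun k ω =>
    (k.factorial : ℝ)⁻¹ * ((y - x) ^ k * (X ω ^ k * Real.exp (x * X ω))) with hterm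
  have hint (k : ℕ) : Integrable (term k) μ :=
    ((integrable_pow_mul_exp_of_mem_interior_integrableExpSet hx k).const_mul _).const_mul _
  have hnonneg (k : ℕ) : 0 ≤ᵐ[μ] term k := by
    filter_upwards [hX] with ω hω
    have : 0 ≤ (y - x) * X ω := mul_nonneg_of_nonpos_of_nonpos (sub_nonpos.2 hyx) hω
    simp only [hterm, Pi.zero_apply, ← mul_assoc, ← mul_pow]
    positivity
  refine ⟨(by fun_prop : AEMeasurable _ μ).aestronglyMeasurable, ?_⟩
  rw [hasFiniteIntegral_iff_ofReal (ae_of_all _ fun _ => (Real.exp_pos _).le)]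
  calc ∫⁻ ω, ENNReal.ofReal (Real.exp (y * X ω)) ∂μ
      = ∫⁻ ω, ∑' k, ENNReal.ofReal (term k ω) ∂μ := by
        refine lintegral_congr_ae ?_
        filter_upwards [ae_all_iff.2 hnonneg] with ω hω
        have hs := hasSum_pow_mul_exp x y (X ω)
        rw [← hs.tsum_eq, ENNReal.ofReal_tsum_of_nonneg hω hs.summable]
    _ = ∑' k, ∫⁻ ω, ENNReal.ofReal (term k ω) ∂μ :=
        lintegral_tsum fun k => (hint k).1.aemeasurable.ennreal_ofReal
    _ = ∑' k : ℕ, ENNReal.ofReal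
          ((k.factorial : ℝ)⁻¹ * ((y - x) ^ k * ∫ ω, X ω ^ k * Real.exp (x * X ω) ∂μ)) := by
        refine tsum_congr fun k => ?_
        rw [← ofReal_integral_eq_lintegral_ofReal (hint k) (hnonneg k), integral_const_mul,
          integral_const_mul]
    _ < ⊤ := hsum.tsum_ofReal_ne_top.lt_top

theorem mem_integrableExpSet_of_differentiableOn_ball (hX : X ≤ᵐ[μ] 0)
    (hx : x ∈ interior (integrableExpSet X μ)) {H : ℂ → ℂ} {r : ℝ}
    (hH : DifferentiableOn ℂ H (Metric.ball (x : ℂ) r)) (heq : H =ᶠ[𝓝 (x : ℂ)] complexMGF X μ)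
    (hyx : y ≤ x) (hy : x - r < y) : y ∈ integrableExpSet X μ := by
  refine mem_integrableExpSet_of_summable hX hx hyx ?_
  have hderiv (k : ℕ) :
      iteratedDeriv k H x = ((∫ ω, X ω ^ k * Real.exp (x * X ω) ∂μ : ℝ) : ℂ) := by
    rw [heq.iteratedDeriv_eq, iteratedDeriv_complexMGF (by simpa using hx),
      ← integral_complex_ofReal]
    simp
  have hy_mem : (y : ℂ) ∈ Metric.ball (x : ℂ) r := by
    rw [Metric.mem_ball, Complex.dist_eq, ← Complex.ofReal_sub, Complex.norm_real,
      Real.norm_of_nonpos (sub_nonpos.2 hyx)]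
    linarith
  rw [← Complex.summable_ofReal]
  refine (Complex.hasSum_taylorSeries_on_ball hH hy_mem).summable.congr fun k => ?_
  rw [hderiv]
  push_cast [smul_eq_mul]
  rfl

theorem Ioi_sInf_subset_interior_integrableExpSet (hX : X ≤ᵐ[μ] 0) (hXm : AEMeasurable X μ)
    (hne : (integrableExpSet X μ).Nonempty) :
    Ioi (sInf (integrableExpSet X μ)) ⊆ interior (integrableExpSet X μ) := by
  refine interior_maximal (fun v hv => ?_) isOpen_Ioi
  obtain ⟨w, hw, hwv⟩ := exists_lt_of_csInf_lt hne hv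
  exact mem_integrableExpSet_of_nonpos hX hXm hw hwv.le

theorem exists_sInf_integrableExpSet_le_not_analyticAt (hX : X ≤ᵐ[μ] 0)
    (hx : x ∈ interior (integrableExpSet X μ)) (hbdd : BddBelow (integrableExpSet X μ))
    {H : ℂ → ℂ} (heq : H =ᶠ[𝓝 (x : ℂ)] complexMGF X μ) :
    ∃ y : ℝ, sInf (integrableExpSet X μ) ≤ y ∧ ¬AnalyticAt ℂ H y := by
  by_contra! hH
  have hsub := Ioi_sInf_subset_interior_integrableExpSet hX
    (aemeasurable_of_mem_interior_integrableExpSet hx) ⟨x, interior_subset hx⟩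
  set S := sInf (integrableExpSet X μ)
  have hSx : S < x := by
    obtain ⟨v, hvx, hv⟩ := Filter.Eventually.exists_lt (mem_interior_iff_mem_nhds.1 hx)
    exact (csInf_le hbdd hv).trans_lt hvx
  obtain ⟨ε, hε, hH_ball⟩ :
      ∃ ε > 0, DifferentiableOn ℂ H (Metric.ball (S : ℂ) ε) := by
    obtain ⟨ε, hε, h⟩ := Metric.eventually_nhds_iff_ball.1 (hH S le_rfl).eventually_analyticAt
    exact ⟨ε, hε, fun z hz => (h z hz).differentiableAt.differentiableWithinAt⟩
  have heq_near : H =ᶠ[𝓝 ((S + ε / 4 : ℝ) : ℂ)] complexMGF X μ :=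
    eventuallyEq_of_analyticOnNhd_of_isPreconnected (U := (fun v : ℝ => (v : ℂ)) '' Ioi S)
      (isPreconnected_Ioi.image _ Complex.continuous_ofReal.continuousOn)
      (forall_mem_image.2 fun v hv => hH v (mem_Ioi.1 hv).le)
      (forall_mem_image.2 fun v hv => analyticAt_complexMGF (by simpa using hsub hv))
      (mem_image_of_mem _ hSx) (mem_image_of_mem _ (by simpa using hε)) heq
  -- Pringsheim at `S + ε / 4`, where the ball of radius `3 / 4 * ε` reaches beyond `S`.
  have hmem : S - ε / 4 ∈ integrableExpSet X μ := by
    refine mem_integrableExpSet_of_differentiableOn_ball hX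
      (hsub (by simpa using hε : S + ε / 4 ∈ Ioi S)) (r := 3 / 4 * ε)
      (hH_ball.mono (Metric.ball_subset_ball' ?_)) heq_near (by linarith) (by linarith)
    rw [Complex.dist_eq, ← Complex.ofReal_sub, Complex.norm_real, add_sub_cancel_left,
      Real.norm_of_nonneg (by positivity)]
    linarith
  linarith [csInf_le hbdd hmem]

theorem Ioi_subset_integrableExpSet (hX : X ≤ᵐ[μ] 0)
    (hx : x ∈ interior (integrableExpSet X μ)) {H : ℂ → ℂ}
    (heq : H =ᶠ[𝓝 (x : ℂ)] complexMGF X μ) {a : ℝ}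
    (hH : ∀ y : ℝ, a < y → AnalyticAt ℂ H y) : Ioi a ⊆ integrableExpSet X μ := by
  intro y (hy : a < y)
  by_contra hyD
  have hy_le : ∀ v ∈ integrableExpSet X μ, y ≤ v := fun v hv => by
    by_contra! hvy
    exact hyD (mem_integrableExpSet_of_nonpos hX
      (aemeasurable_of_mem_interior_integrableExpSet hx) hv hvy.le)
  obtain ⟨w, hw, hw_sing⟩ := exists_sInf_integrableExpSet_le_not_analyticAt hX hx ⟨y, hy_le⟩ heq
  have hyw : y ≤ w := (le_csInf ⟨x, interior_subset hx⟩ hy_le).trans hw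
  exact hw_sing (hH w (hy.trans_le hyw))

end Landau

section LaplaceTransform

open MeasureTheory ProbabilityTheory Set

variable {F : Type*} [NormedAddCommGroup F] [NormedSpace ℂ F] {ν : Measure ℝ}

/-- Convergence of the Laplace integral `∫ e^{-zt} u(t) dν(t)`. -/
def LaplaceIntegrable (ν : Measure ℝ) (u : ℝ → F) (z : ℂ) : Prop :=
  Integrable (fun t : ℝ => Complex.exp (-z * t) • u t) ν

/-- The Laplace transform `z ↦ ∫ e^{-zt} u(t) dν(t)`, with value `0` where the integral diverges.
The measure `ν` carries the domain of integration: `volume.restrict (Ioi 0)` for the usual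
transform, further restrictions of it for the contribution of a part of the half-line. -/
noncomputable def laplaceTransform (ν : Measure ℝ) (u : ℝ → F) (z : ℂ) : F :=
  ∫ t : ℝ, Complex.exp (-z * t) • u t ∂ν

variable {u : ℝ → F} {z w : ℂ}

namespace LaplaceIntegrable

theorem aestronglyMeasurable (h : LaplaceIntegrable ν u w) : AEStronglyMeasurable u ν := by
  have hexp : AEStronglyMeasurable (fun t : ℝ => Complex.exp (w * t)) ν :=
    Continuous.aestronglyMeasurable (by fun_prop)
  refine (hexp.smul h.1).congr (ae_of_all _ fun t => ?_)
  simp [smul_smul, ← Complex.exp_add]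

theorem of_norm_exp_le (h : LaplaceIntegrable ν u w) {C : ℝ}
    (hC : ∀ᵐ t : ℝ ∂ν, ‖Complex.exp ((w - z) * t)‖ ≤ C) : LaplaceIntegrable ν u z := by
  refine (h.bdd_smul C (φ := fun t : ℝ => Complex.exp ((w - z) * t))
    (Continuous.aestronglyMeasurable (by fun_prop)) hC).congr (ae_of_all _ fun t => ?_)
  simp only [Pi.smul_apply', smul_smul, ← Complex.exp_add]
  ring_nf

theorem of_ae_abs_le (h : LaplaceIntegrable ν u w) {τ : ℝ} (hν : ∀ᵐ t ∂ν, |t| ≤ τ) (z : ℂ) :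
    LaplaceIntegrable ν u z := by
  refine h.of_norm_exp_le (C := Real.exp (‖w - z‖ * τ)) ?_
  filter_upwards [hν] with t ht
  rw [Complex.norm_exp]
  refine Real.exp_le_exp.2 ((Complex.re_le_norm _).trans ?_)
  rw [norm_mul, Complex.norm_real]
  gcongr
  exact ht

theorem of_re_le (h : LaplaceIntegrable ν u w) (hν : ∀ᵐ t ∂ν, 0 ≤ t) (hwz : w.re ≤ z.re) :
    LaplaceIntegrable ν u z := by
  refine h.of_norm_exp_le (C := 1) ?_
  filter_upwards [hν] with t ht
  rw [Complex.norm_exp, Complex.re_mul_ofReal, Complex.sub_re, Real.exp_le_one_iff]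
  exact mul_nonpos_of_nonpos_of_nonneg (sub_nonpos.2 hwz) ht

theorem of_restrict_Iic_of_restrict_Ioi {τ : ℝ} (hle : LaplaceIntegrable (ν.restrict (Iic τ)) u z)
    (hgt : LaplaceIntegrable (ν.restrict (Ioi τ)) u z) : LaplaceIntegrable ν u z := by
  rw [LaplaceIntegrable, ← integrableOn_univ, ← Iic_union_Ioi (a := τ)]
  exact IntegrableOn.union hle hgt

end LaplaceIntegrable

theorem laplaceTransform_eq_add (h : LaplaceIntegrable ν u z) (τ : ℝ) :
    laplaceTransform ν u z =
      laplaceTransform (ν.restrict (Iic τ)) u z + laplaceTransform (ν.restrict (Ioi τ)) u z := by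
  rw [← compl_Iic]
  exact (integral_add_compl measurableSet_Iic h).symm

theorem differentiable_laplaceTransform_of_ae_abs_le (h : LaplaceIntegrable ν u w) {τ : ℝ}
    (hν : ∀ᵐ t ∂ν, |t| ≤ τ) : Differentiable ℂ (laplaceTransform ν u) := by
  intro z
  have hu : Integrable u ν := by
    simpa [LaplaceIntegrable] using h.of_ae_abs_le hν 0
  refine (hasDerivAt_integral_of_dominated_loc_of_deriv_le (Metric.ball_mem_nhds z one_pos)
    (F := fun (z : ℂ) (t : ℝ) => Complex.exp (-z * t) • u t)
    (F' := fun (z : ℂ) (t : ℝ) => (Complex.exp (-z * t) * -t) • u t)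
    (bound := fun t => Real.exp ((‖z‖ + 1) * τ) * τ * ‖u t‖)
    (Eventually.of_forall fun v => (h.of_ae_abs_le hν v).1) (h.of_ae_abs_le hν z) ?_ ?_
    (hu.norm.const_mul _) ?_).2.differentiableAt
  · exact (Continuous.aestronglyMeasurable (by fun_prop)).smul hu.1
  · filter_upwards [hν] with t ht v hv
    have hv_norm : ‖v‖ ≤ ‖z‖ + 1 := by
      linarith [norm_le_norm_add_norm_sub' v z, mem_ball_iff_norm.1 hv]
    have := (abs_nonneg t).trans ht
    rw [norm_smul, norm_mul, norm_neg, Complex.norm_real, Complex.norm_exp]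
    gcongr
    · refine (Complex.re_le_norm _).trans ?_
      rw [norm_mul, norm_neg, Complex.norm_real]
      gcongr
      exact ht
    · exact ht
  · refine ae_of_all _ fun t v _ => ?_
    have hlin : HasDerivAt (fun v : ℂ => -v * t) (-(t : ℂ)) v := by
      simpa using (hasDerivAt_id v).neg.mul_const (t : ℂ)
    exact hlin.cexp.smul_const _

open scoped ComplexOrder

variable {u : ℝ → ℂ}

theorem complexMGF_withDensity_eq_laplaceTransform (hum : AEStronglyMeasurable u ν)
    (hu : ∀ᵐ t ∂ν, 0 ≤ u t) :
    complexMGF (fun t => -t) (ν.withDensity fun t => ENNReal.ofReal (u t).re) =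
      laplaceTransform ν u := by
  ext z
  rw [complexMGF, laplaceTransform, integral_withDensity_eq_integral_toReal_smul₀
    (by fun_prop) (ae_of_all _ fun _ => ENNReal.ofReal_lt_top)]
  refine integral_congr_ae ?_
  filter_upwards [hu] with t ht
  obtain ⟨r, hr, hrt⟩ := RCLike.nonneg_iff_exists_ofReal.1 ht
  rw [← hrt]
  simp [ENNReal.toReal_ofReal hr, mul_comm]

theorem mem_integrableExpSet_withDensity_iff (hum : AEStronglyMeasurable u ν)
    (hu : ∀ᵐ t ∂ν, 0 ≤ u t) :
    z.re ∈ integrableExpSet (fun t => -t) (ν.withDensity fun t => ENNReal.ofReal (u t).re) ↔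
      LaplaceIntegrable ν u z := by
  rw [integrableExpSet, mem_ofPred_eq, integrable_withDensity_iff_integrable_smul₀'
    (by fun_prop) (ae_of_all _ fun _ => ENNReal.ofReal_lt_top)]
  have hexp : Continuous fun t : ℝ => Complex.exp (-z * t) := by fun_prop
  refine integrable_congr' (AEMeasurable.aestronglyMeasurable (by fun_prop))
    (hexp.aestronglyMeasurable.smul hum) ?_
  filter_upwards [hu] with t ht
  obtain ⟨r, hr, hrt⟩ := RCLike.nonneg_iff_exists_ofReal.1 ht
  rw [← hrt]
  simp [ENNReal.toReal_ofReal hr, mul_comm, Complex.norm_exp]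

theorem differentiableOn_laplaceTransform_of_nonneg (hν : ∀ᵐ t ∂ν, 0 ≤ t)
    (hu : ∀ᵐ t ∂ν, 0 ≤ u t) {b x : ℝ} (hb : LaplaceIntegrable ν u b) (hbx : b < x) {H : ℂ → ℂ}
    (heq : H =ᶠ[𝓝 (x : ℂ)] laplaceTransform ν u) {a : ℝ}
    (hH : ∀ y : ℝ, a < y → AnalyticAt ℂ H y) :
    (∀ z : ℂ, a < z.re → LaplaceIntegrable ν u z) ∧
      DifferentiableOn ℂ (laplaceTransform ν u) {z | a < z.re} := by
  have hum := hb.aestronglyMeasurable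
  have htrans := complexMGF_withDensity_eq_laplaceTransform hum hu
  set μ := ν.withDensity fun t => ENNReal.ofReal (u t).re
  have hneg : (fun t => -t) ≤ᵐ[μ] (0 : ℝ → ℝ) := by
    filter_upwards [(withDensity_absolutelyContinuous ν _).ae_le hν] with t ht
    simpa using ht
  have hbx' : x ∈ interior (integrableExpSet (fun t => -t) μ) :=
    interior_maximal (fun y (hy : b < y) => mem_integrableExpSet_of_nonpos hneg (by fun_prop)
      ((mem_integrableExpSet_withDensity_iff hum hu).2 hb) hy.le) isOpen_Ioi hbx
  have hsub : Ioi a ⊆ integrableExpSet (fun t => -t) μ :=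
    Ioi_subset_integrableExpSet hneg hbx' (htrans ▸ heq) hH
  refine ⟨fun z hz => (mem_integrableExpSet_withDensity_iff hum hu).1 (hsub hz), ?_⟩
  rw [← htrans]
  exact differentiableOn_complexMGF.mono fun z hz => interior_maximal hsub isOpen_Ioi hz

theorem differentiableOn_laplaceTransform_of_eventually_nonneg (hν : ∀ᵐ t ∂ν, 0 ≤ t)
    (hu : ∀ᶠ t in atTop, 0 ≤ u t) {b x : ℝ} (hb : LaplaceIntegrable ν u b) (hbx : b < x)
    {H : ℂ → ℂ} (heq : H =ᶠ[𝓝 (x : ℂ)] laplaceTransform ν u) {a : ℝ}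
    (hH : ∀ y : ℝ, a < y → AnalyticAt ℂ H y) :
    DifferentiableOn ℂ (laplaceTransform ν u) {z | a < z.re} := by
  obtain ⟨τ, hτ⟩ := eventually_atTop.1 hu
  set head := laplaceTransform (ν.restrict (Iic τ)) u
  set tail := laplaceTransform (ν.restrict (Ioi τ)) u
  have hb_head : LaplaceIntegrable (ν.restrict (Iic τ)) u b :=
    hb.mono_measure Measure.restrict_le_self
  have hb_tail : LaplaceIntegrable (ν.restrict (Ioi τ)) u b :=
    hb.mono_measure Measure.restrict_le_self
  have hν_head : ∀ᵐ t ∂ν.restrict (Iic τ), |t| ≤ τ := by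
    filter_upwards [ae_restrict_mem measurableSet_Iic, ae_restrict_of_ae hν] with t ht ht₀
    rwa [abs_of_nonneg ht₀]
  have hu_tail : ∀ᵐ t ∂ν.restrict (Ioi τ), 0 ≤ u t := by
    filter_upwards [ae_restrict_mem measurableSet_Ioi] with t ht using hτ t (mem_Ioi.1 ht).le
  have hhead : Differentiable ℂ head :=
    differentiable_laplaceTransform_of_ae_abs_le hb_head hν_head
  have heq_tail : (fun z => H z - head z) =ᶠ[𝓝 (x : ℂ)] tail := by
    filter_upwards [heq, (isOpen_lt continuous_const Complex.continuous_re).mem_nhds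
      (by simpa using hbx : b < (x : ℂ).re)] with z hz hbz
    rw [hz, laplaceTransform_eq_add (hb.of_re_le hν hbz.le) τ, add_sub_cancel_left]
  obtain ⟨hint_tail, hdiff_tail⟩ := differentiableOn_laplaceTransform_of_nonneg
    (ae_restrict_of_ae hν) hu_tail hb_tail hbx heq_tail
    fun y hy => (hH y hy).sub (hhead.analyticAt y)
  refine (hhead.differentiableOn.add hdiff_tail).congr fun z hz => laplaceTransform_eq_add ?_ τ
  exact .of_restrict_Iic_of_restrict_Ioi (hb_head.of_ae_abs_le hν_head z) (hint_tail z hz)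

end LaplaceTransform

section LaplaceTransformOperations

open MeasureTheory Set

variable {F F' : Type*} [NormedAddCommGroup F] [NormedSpace ℂ F] [NormedAddCommGroup F']
  [NormedSpace ℂ F'] {ν : Measure ℝ} {u v : ℝ → F} {z : ℂ}

theorem laplaceTransform_add (hu : LaplaceIntegrable ν u z) (hv : LaplaceIntegrable ν v z) :
    laplaceTransform ν (u + v) z = laplaceTransform ν u z + laplaceTransform ν v z := by
  simpa only [laplaceTransform, Pi.add_apply, smul_add] using integral_add hu hv

theorem laplaceTransform_const_smul (c : ℂ) (u : ℝ → F) (z : ℂ) :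
    laplaceTransform ν (c • u) z = c • laplaceTransform ν u z := by
  simp only [laplaceTransform, Pi.smul_apply, smul_comm _ c, integral_smul]

theorem LaplaceIntegrable.clm_apply (hu : LaplaceIntegrable ν u z) (L : F →L[ℂ] F') :
    LaplaceIntegrable ν (fun t => L (u t)) z := by
  simpa only [LaplaceIntegrable, map_smul] using L.integrable_comp hu

theorem laplaceTransform_clm_apply [CompleteSpace F] [CompleteSpace F']
    (hu : LaplaceIntegrable ν u z) (L : F →L[ℂ] F') :
    laplaceTransform ν (fun t => L (u t)) z = L (laplaceTransform ν u z) := by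
  simpa only [laplaceTransform, map_smul] using L.integral_comp_comm hu

theorem laplaceTransform_Ioi_comp_add_right {h : ℝ} (hh : 0 ≤ h)
    (hu : LaplaceIntegrable (volume.restrict (Ioi 0)) u z) :
    laplaceTransform (volume.restrict (Ioi 0)) (fun t => u (t + h)) z = Complex.exp (z * h) •
      (laplaceTransform (volume.restrict (Ioi 0)) u z -
        ∫ t in (0 : ℝ)..h, Complex.exp (-z * t) • u t) := by
  have hshift := (measurePreserving_add_right volume h).setIntegral_preimage_emb
    (measurableEmbedding_addRight h) (fun t : ℝ => Complex.exp (-z * t) • u t) (Ioi h)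
  rw [preimage_add_const_Ioi, sub_self] at hshift
  rw [laplaceTransform, laplaceTransform, ← intervalIntegral.integral_Ioi_sub_Ioi hu hh,
    sub_sub_cancel, ← hshift, ← integral_smul]
  refine integral_congr_ae (ae_of_all _ fun t => ?_)
  simp only [smul_smul, ← Complex.exp_add, Complex.ofReal_add]
  ring_nf

theorem hasDerivAt_exp_smul_sub_integral_zero [CompleteSpace F] (hu : Continuous u) (L : F)
    (z : ℂ) :
    HasDerivAt
      (fun h : ℝ => Complex.exp (z * h) • (L - ∫ t in (0 : ℝ)..h, Complex.exp (-z * t) • u t))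
      (z • L - u 0) 0 := by
  have hg : Continuous fun t : ℝ => Complex.exp (-z * t) • u t := by fun_prop
  have hint := intervalIntegral.integral_hasDerivAt_right (hg.intervalIntegrable 0 0)
    (hg.stronglyMeasurableAtFilter _ _) hg.continuousAt
  have hexp : HasDerivAt (fun h : ℝ => Complex.exp (z * h)) z 0 := by
    simpa using ((Complex.ofRealCLM.hasDerivAt (x := (0 : ℝ))).const_mul z).cexp
  refine (hexp.smul (hint.const_sub L)).congr_deriv ?_
  simp only [Complex.ofReal_zero, mul_zero, Complex.exp_zero, one_smul,
    intervalIntegral.integral_same, sub_zero]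
  abel

end LaplaceTransformOperations

section Resolvent

variable {E : Type*} [NormedAddCommGroup E] [NormedSpace ℂ E] {A : E →ₗ.[ℂ] E} {μ z : ℂ}
  {R S : E →L[ℂ] E}

/-- `R` is the bounded inverse `(μ - A)⁻¹` of the unbounded operator `A`; the two fields say that
it is a right and a left inverse of `μ - A : D(A) → E`. -/
structure IsResolventAt (A : E →ₗ.[ℂ] E) (μ : ℂ) (R : E →L[ℂ] E) : Prop where
  right_inverse : ∀ f : E, ∃ h : R f ∈ A.domain, μ • R f - A ⟨R f, h⟩ = f
  left_inverse : ∀ f : A.domain, R (μ • (f : E) - A f) = f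

open Classical in
/-- The resolvent `(μ - A)⁻¹` as a function of `μ`, with value `0` outside the resolvent set. -/
noncomputable def resolventOp (A : E →ₗ.[ℂ] E) (μ : ℂ) : E →L[ℂ] E :=
  if h : μ ∈ A.resolventSet then h.choose else 0

theorem isResolventAt_resolventOp (h : μ ∈ A.resolventSet) :
    IsResolventAt A μ (resolventOp A μ) := by
  rw [resolventOp, dif_pos h]
  exact ⟨h.choose_spec.1, h.choose_spec.2⟩

namespace IsResolventAt

theorem mem_resolventSet (h : IsResolventAt A μ R) : μ ∈ A.resolventSet :=
  ⟨R, h.right_inverse, h.left_inverse⟩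

theorem mem_domain (h : IsResolventAt A μ R) (f : E) : R f ∈ A.domain :=
  (h.right_inverse f).1

theorem smul_sub_apply (h : IsResolventAt A μ R) (f : E) :
    μ • R f - A ⟨R f, h.mem_domain f⟩ = f :=
  (h.right_inverse f).2

theorem unique (hR : IsResolventAt A μ R) (hS : IsResolventAt A μ S) : R = S := by
  ext f
  simpa only [hS.smul_sub_apply] using hR.left_inverse ⟨S f, hS.mem_domain f⟩

theorem resolventOp_eq (h : IsResolventAt A μ R) : resolventOp A μ = R :=
  (isResolventAt_resolventOp h.mem_resolventSet).unique h

theorem perturb (h : IsResolventAt A μ R) (hu : IsUnit (1 + (z - μ) • R)) :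
    IsResolventAt A z (R * Ring.inverse (1 + (z - μ) • R)) := by
  set N := Ring.inverse (1 + (z - μ) • R)
  have hcomm : Commute R N := by
    obtain ⟨v, hv⟩ := hu
    have hRv : Commute R v := by
      rw [hv]
      exact .add_right (.one_right R) (.smul_right (.refl R) _)
    simpa only [N, ← hv, Ring.inverse_unit] using hRv.units_inv_right
  have add_smul_inverse (f : E) : N f + (z - μ) • R (N f) = f :=
    DFunLike.congr_fun (Ring.mul_inverse_cancel _ hu) f
  have inverse_add_smul (f : E) : N (f + (z - μ) • R f) = f :=
    DFunLike.congr_fun (Ring.inverse_mul_cancel _ hu) f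
  refine ⟨fun f => ⟨h.mem_domain (N f), ?_⟩, fun x => ?_⟩
  · calc z • R (N f) - A ⟨R (N f), _⟩
        = (μ • R (N f) - A ⟨R (N f), h.mem_domain _⟩) + (z - μ) • R (N f) := by module
      _ = f := by rw [h.smul_sub_apply, add_smul_inverse]
  · calc (R * N) (z • (x : E) - A x)
        = N (R ((μ • (x : E) - A x) + (z - μ) • (x : E))) := by
          rw [hcomm.eq]
          exact congrArg (fun y => N (R y)) (by module)
      _ = x := by rw [map_add, map_smul, h.left_inverse, inverse_add_smul]

theorem subScalar_apply (h : IsResolventAt A z R) (μ : ℂ) (f : E) :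
    A.subScalar μ ⟨R f, h.mem_domain f⟩ = ((z - μ) • R - 1) f := by
  calc A ⟨R f, h.mem_domain f⟩ - μ • R f
      = (z - μ) • R f - (z • R f - A ⟨R f, h.mem_domain f⟩) := by module
    _ = (z - μ) • R f - f := by rw [h.smul_sub_apply]

theorem exists_apply_eq (h : IsResolventAt A z R) (x : A.domain) :
    ∃ f, (⟨R f, h.mem_domain f⟩ : A.domain) = x :=
  ⟨z • (x : E) - A x, Subtype.ext (h.left_inverse x)⟩

theorem range_smul_sub_one (h : IsResolventAt A z R) (μ : ℂ) :
    ((z - μ) • R - 1).range = (A.subScalar μ).range := by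
  ext g
  constructor
  · rintro ⟨f, rfl⟩
    exact ⟨_, h.subScalar_apply μ f⟩
  · rintro ⟨x, rfl⟩
    obtain ⟨f, rfl⟩ := h.exists_apply_eq x
    exact ⟨f, (h.subScalar_apply μ f).symm⟩

theorem ker_smul_sub_one_eq_bot (h : IsResolventAt A z R) (hker : (A.subScalar μ).ker = ⊥) :
    ((z - μ) • R - 1).ker = ⊥ := by
  refine LinearMap.ker_eq_bot'.2 fun f hf => ?_
  have hRf : (⟨R f, h.mem_domain f⟩ : A.domain) = 0 :=
    LinearMap.ker_eq_bot'.1 hker _ ((h.subScalar_apply μ f).trans hf)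
  have hRf_coe : R f = 0 := congrArg Subtype.val hRf
  rw [← h.smul_sub_apply f, hRf, hRf_coe]
  simp

end IsResolventAt

variable [CompleteSpace E]

namespace IsResolventAt

theorem exists_norm_le_mul_norm_subScalar (h : IsResolventAt A z R)
    (hker : (A.subScalar μ).ker = ⊥) (hrange : FiniteDimensional ℂ (E ⧸ (A.subScalar μ).range)) :
    ∃ K : ℝ≥0, ∀ x : A.domain, ‖(x : E)‖ ≤ K * ‖A.subScalar μ x‖ := by
  set B : E →L[ℂ] E := (z - μ) • R - 1
  have hB_ker : B.ker = ⊥ := h.ker_smul_sub_one_eq_bot hker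
  obtain ⟨G, hG⟩ := Submodule.exists_isCompl B.range
  have : FiniteDimensional ℂ (E ⧸ B.range) := h.range_smul_sub_one μ ▸ hrange
  have : FiniteDimensional ℂ G := (Submodule.quotientEquivOfIsCompl _ _ hG).finiteDimensional
  have hB_closed : IsClosed (B.range : Set E) :=
    B.closed_complemented_range_of_isCompl_of_ker_eq_bot G hG G.closed_of_finiteDimensional hB_ker
  obtain ⟨K, hK⟩ := B.antilipschitz_of_injective_of_isClosed_range
    (LinearMap.ker_eq_bot.1 hB_ker) hB_closed
  refine ⟨‖R‖₊ * K, fun x => ?_⟩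
  obtain ⟨f, rfl⟩ := h.exists_apply_eq x
  calc ‖R f‖ ≤ ‖R‖ * ‖f‖ := R.le_opNorm f
    _ ≤ ‖R‖ * (K * ‖B f‖) := by gcongr; simpa using hK.le_mul_dist f 0
    _ = _ := by rw [h.subScalar_apply, NNReal.coe_mul, coe_nnnorm, mul_assoc]

end IsResolventAt

theorem isUnit_one_add_of_norm_lt_one (h : ‖R‖ < 1) : IsUnit (1 + R) := by
  simpa using isUnit_one_sub_of_norm_lt_one (x := -R) (by rwa [norm_neg])

theorem eventually_isUnit_one_add_sub_smul (R : E →L[ℂ] E) (μ : ℂ) :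
    ∀ᶠ z in 𝓝 μ, IsUnit (1 + (z - μ) • R) := by
  have hcont : ContinuousAt (fun z => ‖(z - μ) • R‖) μ := by fun_prop
  exact (hcont.eventually (gt_mem_nhds (by simp))).mono fun z => isUnit_one_add_of_norm_lt_one

theorem isOpen_resolventSet (A : E →ₗ.[ℂ] E) : IsOpen A.resolventSet :=
  isOpen_iff_mem_nhds.2 fun μ hμ =>
    (eventually_isUnit_one_add_sub_smul (resolventOp A μ) μ).mono fun _ hz =>
      ((isResolventAt_resolventOp hμ).perturb hz).mem_resolventSet

theorem differentiableAt_resolventOp (hμ : μ ∈ A.resolventSet) :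
    DifferentiableAt ℂ (resolventOp A) μ := by
  set R := resolventOp A μ
  have heq : resolventOp A =ᶠ[𝓝 μ] fun z => R * Ring.inverse (1 + (z - μ) • R) :=
    (eventually_isUnit_one_add_sub_smul R μ).mono fun z hz =>
      ((isResolventAt_resolventOp hμ).perturb hz).resolventOp_eq
  have hinv : DifferentiableAt ℂ (Ring.inverse : (E →L[ℂ] E) → _) (1 + (μ - μ) • R) :=
    differentiableAt_inverse (by simp)
  have hadd : DifferentiableAt ℂ (fun z : ℂ => 1 + (z - μ) • R) μ := by fun_prop
  exact ((hinv.comp μ hadd).const_mul R).congr_of_eventuallyEq heq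

theorem differentiableOn_clm_resolventOp (A : E →ₗ.[ℂ] E) (ℓ : E →L[ℂ] ℂ) (f : E) :
    DifferentiableOn ℂ (fun z => ℓ (resolventOp A z f)) A.resolventSet := fun z hz =>
  (ℓ.differentiableAt.comp z ((differentiableAt_resolventOp hz).clm_apply
    (differentiableAt_const f))).differentiableWithinAt

theorem mem_resolventSet_of_mem_closure_of_norm_le {K : ℝ≥0}
    (hK : ∀ x : A.domain, ‖(x : E)‖ ≤ K * ‖A.subScalar μ x‖) (hμ : μ ∈ closure A.resolventSet) :
    μ ∈ A.resolventSet := by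
  obtain ⟨z, hz, hdist⟩ := Metric.mem_closure_iff.1 hμ (1 / (2 * K + 1)) (by positivity)
  rw [dist_eq_norm, lt_div_iff₀ (by positivity)] at hdist
  have hS := isResolventAt_resolventOp hz
  set S := resolventOp A z
  have norm_le : ‖S‖ ≤ 2 * K := by
    refine S.opNorm_le_bound (by positivity) fun g => ?_
    have hSg : ‖S g‖ ≤ K * (‖μ - z‖ * ‖S g‖ + ‖g‖) := by
      refine (hK ⟨S g, hS.mem_domain g⟩).trans ?_
      rw [hS.subScalar_apply, norm_sub_rev μ, ← norm_smul]
      gcongr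
      exact norm_sub_le _ _
    nlinarith [norm_nonneg (S g), norm_nonneg (μ - z)]
  refine (hS.perturb (isUnit_one_add_of_norm_lt_one ?_)).mem_resolventSet
  rw [norm_smul]
  nlinarith [norm_nonneg (μ - z)]

theorem mem_resolventSet_of_mem_closure_of_ker_eq_bot (hμ : μ ∈ closure A.resolventSet)
    (hF : μ ∈ A.fredholmDomain) (hker : (A.subScalar μ).ker = ⊥) : μ ∈ A.resolventSet := by
  obtain ⟨z, hz⟩ := closure_nonempty_iff.1 ⟨μ, hμ⟩
  obtain ⟨K, hK⟩ := (isResolventAt_resolventOp hz).exists_norm_le_mul_norm_subScalar hker hF.2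
  exact mem_resolventSet_of_mem_closure_of_norm_le hK hμ

end Resolvent

section WeakExtension

theorem eventually_forall_eq_of_frequently_eventually {κ : Type*} {F G : κ → ℂ → ℂ} {U : Set ℂ}
    {μ : ℂ} (hU : U ∈ 𝓝 μ) (hF : ∀ j, DifferentiableOn ℂ (F j) U)
    (hG : ∀ j, DifferentiableOn ℂ (G j) U) (h : ∃ᶠ z in 𝓝 μ, ∀ᶠ w in 𝓝 z, ∀ j, F j w = G j w) :
    ∀ᶠ w in 𝓝 μ, ∀ j, F j w = G j w := by
  obtain ⟨r, hr, hball⟩ := Metric.mem_nhds_iff.1 hU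
  have hμ_ball : Metric.ball μ r ∈ 𝓝 μ := Metric.ball_mem_nhds μ hr
  obtain ⟨z, hz, hzμ⟩ := (h.and_eventually hμ_ball).exists
  filter_upwards [hμ_ball] with w hw j
  exact ((hF j).mono hball |>.analyticOnNhd Metric.isOpen_ball).eqOn_of_preconnected_of_eventuallyEq
    ((hG j).mono hball |>.analyticOnNhd Metric.isOpen_ball) (convex_ball μ r).isPreconnected hzμ
    (hz.mono fun y hy => hy j) hw

variable {E : Type*} [NormedAddCommGroup E] [NormedSpace ℂ E] {A : E →ₗ.[ℂ] E} {μ : ℂ}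

-- An eigenvector `x` gives the resolvent a pole: `(z - A)⁻¹ x = (z - μ)⁻¹ x`.
theorem apply_eq_zero_of_frequently_resolventOp_eq {x : A.domain} (hx : A.subScalar μ x = 0)
    {ℓ : E →L[ℂ] ℂ} {G : ℂ → ℂ} (hG : ContinuousAt G μ)
    (h : ∃ᶠ z in 𝓝 μ, z ∈ A.resolventSet ∧ ℓ (resolventOp A z x) = G z) : ℓ x = 0 := by
  have hAx : A x = μ • (x : E) := sub_eq_zero.1 hx
  have smul_resolventOp {z : ℂ} (hz : z ∈ A.resolventSet) :
      (z - μ) • resolventOp A z x = x := by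
    rw [← map_smul, sub_smul, ← hAx]
    exact (isResolventAt_resolventOp hz).left_inverse x
  have hfreq : ∃ᶠ z in 𝓝 μ, (z - μ) * G z = ℓ x := h.mono fun z ⟨hz, hzG⟩ => by
    rw [← hzG, ← smul_eq_mul, ← map_smul, smul_resolventOp hz]
  have hcont : ContinuousAt (fun z => (z - μ) * G z) μ := by fun_prop
  by_contra hne
  exact hfreq (hcont.eventually_ne (by simpa using Ne.symm hne))

variable [CompleteSpace E]

theorem subset_resolventSet_of_weak_extension {Ω : Set ℂ} (hΩ : IsOpen Ω)
    (hconn : IsPreconnected Ω) (hF : Ω ⊆ A.fredholmDomain) {ι : Type*} {ℓ : ι → E →L[ℂ] ℂ}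
    (hsep : ∀ f, (∀ i, ℓ i f = 0) → f = 0) {G : ι → E → ℂ → ℂ}
    (hG : ∀ i f, DifferentiableOn ℂ (G i f) Ω) {z₀ : ℂ} (hz₀ : z₀ ∈ Ω)
    (heq : ∀ᶠ z in 𝓝 z₀, z ∈ A.resolventSet ∧ ∀ i f, ℓ i (resolventOp A z f) = G i f z) :
    Ω ⊆ A.resolventSet := by
  set V : Set ℂ :=
    {z | ∀ᶠ w in 𝓝 z, w ∈ A.resolventSet ∧ ∀ i f, ℓ i (resolventOp A w f) = G i f w}
  suffices h : Ω ⊆ V from fun z hz => (h hz).self_of_nhds.1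
  refine hconn.subset_of_closure_inter_subset isOpen_setOfPred_eventually_nhds ⟨z₀, hz₀, heq⟩ ?_
  rintro μ ⟨hμV, hμΩ⟩
  have hfreq : ∃ᶠ z in 𝓝 μ, z ∈ V := mem_closure_iff_frequently.1 hμV
  have hμ_closure : μ ∈ closure A.resolventSet :=
    closure_mono (fun z hz => hz.self_of_nhds.1) hμV
  have hker : (A.subScalar μ).ker = ⊥ := LinearMap.ker_eq_bot'.2 fun x hx =>
    Subtype.ext <| hsep x fun i => apply_eq_zero_of_frequently_resolventOp_eq hx
      ((hG i x).differentiableAt (hΩ.mem_nhds hμΩ)).continuousAt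
      (hfreq.mono fun z hz => ⟨hz.self_of_nhds.1, hz.self_of_nhds.2 i x⟩)
  have hμ : A.resolventSet ∈ 𝓝 μ := (isOpen_resolventSet A).mem_nhds
    (mem_resolventSet_of_mem_closure_of_ker_eq_bot hμ_closure (hF hμΩ) hker)
  have heq_near : ∀ᶠ w in 𝓝 μ, ∀ j : ι × E, ℓ j.1 (resolventOp A w j.2) = G j.1 j.2 w :=
    eventually_forall_eq_of_frequently_eventually (inter_mem hμ (hΩ.mem_nhds hμΩ))
      (fun j => (differentiableOn_clm_resolventOp A (ℓ j.1) j.2).mono Set.inter_subset_left)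
      (fun j => (hG j.1 j.2).mono Set.inter_subset_right)
      (hfreq.mono fun z hz => hz.mono fun w hw j => hw.2 j.1 j.2)
  filter_upwards [hμ, heq_near] with w hw hw_eq using ⟨hw, fun i f => hw_eq (i, f)⟩

end WeakExtension

section SpectralBound

variable {E : Type*} [NormedAddCommGroup E] [NormedSpace ℂ E] {A : E →ₗ.[ℂ] E}

theorem mem_resolventSet_of_spectralBound_lt {μ : ℂ} (h : A.spectralBound < μ.re) :
    μ ∈ A.resolventSet := by
  by_contra hμ
  exact h.not_ge (le_sSup ⟨μ, hμ, rfl⟩)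

theorem mem_fredholmDomain_of_essentialSpectralBound_lt {μ : ℂ}
    (h : A.essentialSpectralBound < μ.re) : μ ∈ A.fredholmDomain := by
  by_contra hμ
  exact h.not_ge (le_sSup ⟨μ, hμ, rfl⟩)

theorem spectralBound_le {c : ℝ} (h : {z : ℂ | c < z.re} ⊆ A.resolventSet) :
    A.spectralBound ≤ c := by
  refine sSup_le ?_
  rintro _ ⟨z, hz, rfl⟩
  exact EReal.coe_le_coe_iff.2 (not_lt.1 fun hlt => hz (h hlt))

variable [CompleteSpace E]

theorem exists_lt_forall_ofReal_mem_resolventSet {s : ℝ} (hs : A.spectralBound = s)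
    (hmem : (s : ℂ) ∈ A.resolventSet) {b : EReal} (hb : b < s) :
    ∃ c : ℝ, b < c ∧ c < s ∧ ∀ y : ℝ, c < y → (y : ℂ) ∈ A.resolventSet := by
  have hb_near : ∀ᶠ c : ℝ in 𝓝[<] s, b < c :=
    (continuous_coe_real_ereal.continuousAt.eventually (lt_mem_nhds hb)).filter_mono
      nhdsWithin_le_nhds
  have hmem_near : ∀ᶠ y : ℝ in 𝓝 s, (y : ℂ) ∈ A.resolventSet :=
    Complex.continuous_ofReal.continuousAt.eventually ((isOpen_resolventSet A).mem_nhds hmem)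
  obtain ⟨ε, hε, hball⟩ := Metric.eventually_nhds_iff.1 hmem_near
  obtain ⟨c, hbc, hεc, hcs⟩ := (hb_near.and (Ioo_mem_nhdsLT (sub_lt_self s hε))).exists
  refine ⟨c, hbc, hcs, fun y hy => ?_⟩
  rcases le_or_gt y s with hys | hsy
  · refine hball ?_
    rw [Real.dist_eq, abs_sub_comm, abs_of_nonneg (sub_nonneg.2 hys)]
    linarith
  · refine mem_resolventSet_of_spectralBound_lt ?_
    rw [hs, Complex.ofReal_re]
    exact_mod_cast hsy

end SpectralBound

section Semigroup

open MeasureTheory Set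

namespace C0Semigroup

variable {E : Type*} [NormedAddCommGroup E] [NormedSpace ℂ E] {T : C0Semigroup E}

namespace HasGeneratorAt

variable {f g : E}

theorem mem_domain (h : T.HasGeneratorAt f g) : f ∈ T.generator.domain := ⟨g, h⟩

theorem generator_eq (h : T.HasGeneratorAt f g) : T.generator ⟨f, h.mem_domain⟩ = g :=
  tendsto_nhds_unique (T.hasGeneratorAt_generator ⟨f, h.mem_domain⟩) h

theorem map_of_comm (h : T.HasGeneratorAt f g) {R : E →L[ℂ] E}
    (hR : ∀ t x, T.op t (R x) = R (T.op t x)) : T.HasGeneratorAt (R f) (R g) :=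
  ((R.continuous.tendsto g).comp h).congr fun t => by
    simp only [Function.comp_apply, map_smul, map_sub, hR]

end HasGeneratorAt

/-- The exponential growth bound `‖T(t)‖ ≤ M e^{ωt}` for all `t ≥ 0`. -/
def HasGrowthBound (T : C0Semigroup E) (M ω : ℝ) : Prop :=
  ∀ t : ℝ≥0, ‖T.op t‖ ≤ M * Real.exp (ω * t)

theorem norm_op_le_pow {M : ℝ} (hM_one : 1 ≤ M) (hM : ∀ t ≤ 1, ‖T.op t‖ ≤ M) (n : ℕ) {t : ℝ≥0}
    (ht : t ≤ n + 1) : ‖T.op t‖ ≤ M ^ (n + 1) := by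
  induction n generalizing t with
  | zero => simpa using hM t (by simpa using ht)
  | succ n ih =>
    rcases le_total t 1 with h | h
    · exact (hM t h).trans (le_self_pow₀ hM_one (by simp))
    · have ht' : t - 1 ≤ n + 1 := tsub_le_iff_right.2 (by exact_mod_cast ht)
      calc ‖T.op t‖ = ‖(T.op (t - 1)).comp (T.op 1)‖ := by
            rw [← T.op_add, tsub_add_cancel_of_le h]
        _ ≤ ‖T.op (t - 1)‖ * ‖T.op 1‖ := ContinuousLinearMap.opNorm_comp_le _ _
        _ ≤ M ^ (n + 1) * M := by gcongr; exacts [ih ht', hM 1 le_rfl]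
        _ = M ^ (n + 1 + 1) := (pow_succ M (n + 1)).symm

theorem hasGrowthBound_log {M : ℝ} (hM_one : 1 ≤ M) (hM : ∀ t ≤ 1, ‖T.op t‖ ≤ M) :
    T.HasGrowthBound M (Real.log M) := fun t => by
  have hM_pos : 0 < M := one_pos.trans_le hM_one
  calc ‖T.op t‖ ≤ M ^ (⌊t⌋₊ + 1) := norm_op_le_pow hM_one hM _ (Nat.lt_floor_add_one t).le
    _ = M * M ^ (⌊t⌋₊ : ℝ) := by rw [pow_succ', Real.rpow_natCast]
    _ ≤ M * M ^ (t : ℝ) := by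
      gcongr
      exact_mod_cast Nat.floor_le (zero_le (a := t))
    _ = M * Real.exp (Real.log M * t) := by rw [Real.rpow_def_of_pos hM_pos]

theorem exists_hasGrowthBound [CompleteSpace E] (T : C0Semigroup E) :
    ∃ M ω : ℝ, T.HasGrowthBound M ω := by
  obtain ⟨C, hC⟩ : ∃ C, ∀ t : Icc (0 : ℝ≥0) 1, ‖T.op t‖ ≤ C := by
    refine banach_steinhaus fun f => ?_
    obtain ⟨C, hC⟩ := (isCompact_Icc (a := (0 : ℝ≥0)) (b := 1)).exists_bound_of_continuousOn
      (T.continuous_orbit f).continuousOn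
    exact ⟨C, fun t => hC t t.2⟩
  exact ⟨max C 1, _, hasGrowthBound_log (le_max_right _ _) fun t ht =>
    (hC ⟨t, zero_le, ht⟩).trans (le_max_left _ _)⟩

/-- The orbit `t ↦ T(t) f`, extended to negative times by its value `f` at `0`, so that it can be
integrated against measures on `ℝ`. -/
def orbit (T : C0Semigroup E) (f : E) (t : ℝ) : E := T.op t.toNNReal f

@[fun_prop]
theorem continuous_orbit_real (T : C0Semigroup E) (f : E) : Continuous (T.orbit f) :=
  (T.continuous_orbit f).comp continuous_real_toNNReal

theorem orbit_zero (T : C0Semigroup E) (f : E) : T.orbit f 0 = f := by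
  simp [orbit, T.op_zero]

theorem orbit_add (T : C0Semigroup E) (f g : E) : T.orbit (f + g) = T.orbit f + T.orbit g :=
  funext fun _ => map_add _ f g

theorem orbit_smul (T : C0Semigroup E) (c : ℂ) (f : E) : T.orbit (c • f) = c • T.orbit f :=
  funext fun _ => map_smul _ c f

theorem op_comm (T : C0Semigroup E) (s t : ℝ≥0) (f : E) :
    T.op s (T.op t f) = T.op t (T.op s f) := by
  simp only [← ContinuousLinearMap.comp_apply, ← T.op_add, add_comm]

theorem op_orbit (T : C0Semigroup E) (h : ℝ≥0) (f : E) (t : ℝ) :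
    T.op h (T.orbit f t) = T.orbit (T.op h f) t :=
  T.op_comm h t.toNNReal f

theorem op_orbit_of_nonneg (T : C0Semigroup E) (h : ℝ≥0) (f : E) {t : ℝ} (ht : 0 ≤ t) :
    T.op h (T.orbit f t) = T.orbit f (t + h) := by
  rw [orbit, orbit, Real.toNNReal_add ht h.coe_nonneg, Real.toNNReal_coe, add_comm, T.op_add,
    ContinuousLinearMap.comp_apply]

namespace HasGrowthBound

variable {M ω : ℝ} {z : ℂ}

theorem norm_exp_smul_orbit_le (hT : T.HasGrowthBound M ω) (z : ℂ) (f : E) {t : ℝ}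
    (ht : 0 ≤ t) :
    ‖Complex.exp (-z * t) • T.orbit f t‖ ≤ M * Real.exp (-(z.re - ω) * t) * ‖f‖ := by
  calc ‖Complex.exp (-z * t) • T.orbit f t‖
      ≤ Real.exp (-z.re * t) * (M * Real.exp (ω * t) * ‖f‖) := by
        rw [norm_smul, Complex.norm_exp, Complex.re_mul_ofReal, Complex.neg_re]
        gcongr
        simpa only [orbit, Real.coe_toNNReal t ht] using (T.op t.toNNReal).le_of_opNorm_le (hT _) f
    _ = M * (Real.exp (-z.re * t) * Real.exp (ω * t)) * ‖f‖ := by ring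
    _ = M * Real.exp (-(z.re - ω) * t) * ‖f‖ := by rw [← Real.exp_add]; ring_nf

theorem laplaceIntegrable_orbit (hT : T.HasGrowthBound M ω) (hz : ω < z.re) (f : E) :
    LaplaceIntegrable (volume.restrict (Ioi 0)) (T.orbit f) z := by
  have hmajorant := ((exp_neg_integrableOn_Ioi 0 (sub_pos.2 hz)).const_mul M).mul_const ‖f‖
  refine hmajorant.mono' (Continuous.aestronglyMeasurable (by fun_prop)) ?_
  filter_upwards [ae_restrict_mem measurableSet_Ioi] with t ht
  exact hT.norm_exp_smul_orbit_le z f (mem_Ioi.1 ht).le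

theorem norm_laplaceTransform_orbit_le (hT : T.HasGrowthBound M ω) (hz : ω < z.re) (f : E) :
    ‖laplaceTransform (volume.restrict (Ioi 0)) (T.orbit f) z‖ ≤
      (∫ t : ℝ in Ioi 0, M * Real.exp (-(z.re - ω) * t)) * ‖f‖ := by
  rw [← integral_mul_const]
  have hmajorant := ((exp_neg_integrableOn_Ioi 0 (sub_pos.2 hz)).const_mul M).mul_const ‖f‖
  refine norm_integral_le_of_norm_le hmajorant ?_
  filter_upwards [ae_restrict_mem measurableSet_Ioi] with t ht
  exact hT.norm_exp_smul_orbit_le z f (mem_Ioi.1 ht).le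

/-- The Laplace transform `f ↦ ∫₀^∞ e^{-zt} T(t) f dt` of a semigroup with growth bound `ω < Re z`
as a bounded operator; it is the resolvent of the generator at `z`. -/
noncomputable def laplace (hT : T.HasGrowthBound M ω) (hz : ω < z.re) : E →L[ℂ] E :=
  LinearMap.mkContinuous
    { toFun := fun f => laplaceTransform (volume.restrict (Ioi 0)) (T.orbit f) z
      map_add' := fun f g => by
        rw [T.orbit_add, laplaceTransform_add (hT.laplaceIntegrable_orbit hz f)
          (hT.laplaceIntegrable_orbit hz g)]
      map_smul' := fun c f => by
        rw [T.orbit_smul, laplaceTransform_const_smul, RingHom.id_apply] }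
    _ (hT.norm_laplaceTransform_orbit_le hz)

theorem laplace_apply (hT : T.HasGrowthBound M ω) (hz : ω < z.re) (f : E) :
    hT.laplace hz f = laplaceTransform (volume.restrict (Ioi 0)) (T.orbit f) z := rfl

variable [CompleteSpace E]

theorem op_laplace (hT : T.HasGrowthBound M ω) (hz : ω < z.re) (h : ℝ≥0) (f : E) :
    T.op h (hT.laplace hz f) = hT.laplace hz (T.op h f) := by
  rw [laplace_apply, laplace_apply, ← laplaceTransform_clm_apply (hT.laplaceIntegrable_orbit hz f)]
  simp only [T.op_orbit]

theorem op_laplace_eq_exp_smul (hT : T.HasGrowthBound M ω) (hz : ω < z.re) (h : ℝ≥0) (f : E) :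
    T.op h (hT.laplace hz f) = Complex.exp (z * (h : ℝ)) •
      (hT.laplace hz f - ∫ t in (0 : ℝ)..h, Complex.exp (-z * t) • T.orbit f t) := by
  have hint := hT.laplaceIntegrable_orbit hz f
  rw [laplace_apply, ← laplaceTransform_Ioi_comp_add_right h.coe_nonneg hint,
    ← laplaceTransform_clm_apply hint]
  refine setIntegral_congr_fun measurableSet_Ioi fun t ht => ?_
  simp only [T.op_orbit_of_nonneg h f (mem_Ioi.1 ht).le]

theorem hasGeneratorAt_laplace (hT : T.HasGrowthBound M ω) (hz : ω < z.re) (f : E) :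
    T.HasGeneratorAt (hT.laplace hz f) (z • hT.laplace hz f - f) := by
  have hslope := (hasDerivAt_exp_smul_sub_integral_zero (T.continuous_orbit_real f)
    (hT.laplace hz f) z).tendsto_slope_zero_right
  have hcoe : Tendsto (fun h : ℝ≥0 => (h : ℝ)) (𝓝[>] 0) (𝓝[>] 0) :=
    tendsto_nhdsWithin_of_tendsto_nhds_of_eventually_within _
      (NNReal.continuous_coe.continuousAt.tendsto.mono_left nhdsWithin_le_nhds)
      (eventually_mem_nhdsWithin.mono fun _ => NNReal.coe_pos.2)
  rw [T.orbit_zero] at hslope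
  refine (hslope.comp hcoe).congr fun h => ?_
  rw [hT.op_laplace_eq_exp_smul hz, ← Complex.ofReal_inv, Complex.coe_smul]
  simp

theorem isResolventAt_laplace (hT : T.HasGrowthBound M ω) (hz : ω < z.re) :
    IsResolventAt T.generator z (hT.laplace hz) where
  right_inverse f :=
    ⟨(hT.hasGeneratorAt_laplace hz f).mem_domain, by
      rw [(hT.hasGeneratorAt_laplace hz f).generator_eq, sub_sub_cancel]⟩
  left_inverse f := by
    have hgen : hT.laplace hz (T.generator f) = z • hT.laplace hz f - f :=
      tendsto_nhds_unique
        ((T.hasGeneratorAt_generator f).map_of_comm (hT.op_laplace hz))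
        (hT.hasGeneratorAt_laplace hz f)
    rw [map_sub, map_smul, hgen, sub_sub_cancel]

theorem mem_resolventSet (hT : T.HasGrowthBound M ω) (hz : ω < z.re) :
    z ∈ T.generator.resolventSet :=
  (hT.isResolventAt_laplace hz).mem_resolventSet

theorem resolventOp_generator_apply (hT : T.HasGrowthBound M ω) (hz : ω < z.re) (f : E) :
    resolventOp T.generator z f = laplaceTransform (volume.restrict (Ioi 0)) (T.orbit f) z := by
  rw [(hT.isResolventAt_laplace hz).resolventOp_eq, laplace_apply]

open scoped ComplexOrder

theorem exists_extension_of_eventually_nonneg (hT : T.HasGrowthBound M ω) {c : ℝ}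
    (hray : ∀ y : ℝ, c < y → (y : ℂ) ∈ T.generator.resolventSet) {ℓ : E →L[ℂ] ℂ} {f : E}
    (hpos : ∀ᶠ t in atTop, 0 ≤ ℓ (T.op t f)) :
    ∃ G : ℂ → ℂ, DifferentiableOn ℂ G {z | c < z.re} ∧
      ∀ z : ℂ, ω < z.re → G z = ℓ (resolventOp T.generator z f) := by
  have hint {z : ℂ} (hz : ω < z.re) :
      LaplaceIntegrable (volume.restrict (Ioi 0)) (fun t => ℓ (T.orbit f t)) z :=
    (hT.laplaceIntegrable_orbit hz f).clm_apply ℓ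
  have heq (z : ℂ) (hz : ω < z.re) :
      laplaceTransform (volume.restrict (Ioi 0)) (fun t => ℓ (T.orbit f t)) z =
        ℓ (resolventOp T.generator z f) := by
    rw [hT.resolventOp_generator_apply hz,
      laplaceTransform_clm_apply (hT.laplaceIntegrable_orbit hz f)]
  have hu : ∀ᶠ t in atTop, 0 ≤ ℓ (T.orbit f t) := tendsto_real_toNNReal_atTop.eventually hpos
  have heq_near : (fun z => ℓ (resolventOp T.generator z f)) =ᶠ[𝓝 ((ω + 2 : ℝ) : ℂ)]
      laplaceTransform (volume.restrict (Ioi 0)) (fun t => ℓ (T.orbit f t)) := by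
    filter_upwards [(isOpen_lt continuous_const Complex.continuous_re).mem_nhds
      (show ω < ((ω + 2 : ℝ) : ℂ).re by simp)] with z hz using (heq z hz).symm
  have hanalytic (y : ℝ) (hy : c < y) :
      AnalyticAt ℂ (fun z => ℓ (resolventOp T.generator z f)) y :=
    (differentiableOn_clm_resolventOp T.generator ℓ f).analyticAt
      ((isOpen_resolventSet _).mem_nhds (hray y hy))
  exact ⟨_, differentiableOn_laplaceTransform_of_eventually_nonneg
    ((ae_restrict_mem measurableSet_Ioi).mono fun t ht => (mem_Ioi.1 ht).le) hu
    (hint (z := (ω + 1 : ℝ)) (by simp)) (by linarith) heq_near hanalytic, heq⟩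

theorem exists_extension_of_span_eq_top (hT : T.HasGrowthBound M ω) {c : ℝ}
    (hray : ∀ y : ℝ, c < y → (y : ℂ) ∈ T.generator.resolventSet) {ℓ : E →L[ℂ] ℂ} {C : Set E}
    (hC : Submodule.span ℂ C = ⊤) (hpos : ∀ f ∈ C, ∀ᶠ t in atTop, 0 ≤ ℓ (T.op t f)) (f : E) :
    ∃ G : ℂ → ℂ, DifferentiableOn ℂ G {z | c < z.re} ∧
      ∀ z : ℂ, ω < z.re → G z = ℓ (resolventOp T.generator z f) := by
  induction hC ▸ Submodule.mem_top (x := f) using Submodule.span_induction with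
  | mem f hf => exact hT.exists_extension_of_eventually_nonneg hray (hpos f hf)
  | zero => exact ⟨0, differentiableOn_const 0, by simp⟩
  | add f g _ _ hf hg =>
    obtain ⟨F, hF, hF_eq⟩ := hf
    obtain ⟨G, hG, hG_eq⟩ := hg
    exact ⟨F + G, hF.add hG, fun z hz => by simp [hF_eq z hz, hG_eq z hz]⟩
  | smul a f _ hf =>
    obtain ⟨F, hF, hF_eq⟩ := hf
    exact ⟨a • F, hF.const_smul a, fun z hz => by simp [hF_eq z hz]⟩

theorem halfPlane_subset_resolventSet (hT : T.HasGrowthBound M ω) {c : ℝ}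
    (hess : T.generator.essentialSpectralBound < c)
    (hray : ∀ y : ℝ, c < y → (y : ℂ) ∈ T.generator.resolventSet) {ι : Type*} {ℓ : ι → E →L[ℂ] ℂ}
    (hsep : ∀ f, (∀ i, ℓ i f = 0) → f = 0) {C : Set E} (hC : Submodule.span ℂ C = ⊤)
    (hpos : ∀ i, ∀ f ∈ C, ∀ᶠ t in atTop, 0 ≤ ℓ i (T.op t f)) :
    {z : ℂ | c < z.re} ⊆ T.generator.resolventSet := by
  choose G hG hG_eq using fun i => hT.exists_extension_of_span_eq_top hray hC (hpos i)
  obtain ⟨x, hx⟩ := exists_gt (max c ω)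
  have hωx : ω < (x : ℂ).re := (le_max_right c ω).trans_lt hx
  refine subset_resolventSet_of_weak_extension (isOpen_lt continuous_const Complex.continuous_re)
    (convex_halfSpace_re_gt c).isPreconnected
    (fun z hz => mem_fredholmDomain_of_essentialSpectralBound_lt
      (hess.trans (EReal.coe_lt_coe_iff.2 hz))) hsep hG
    (z₀ := x) ((le_max_left c ω).trans_lt hx) ?_
  filter_upwards [(isOpen_lt continuous_const Complex.continuous_re).mem_nhds hωx] with z hz
  exact ⟨hT.mem_resolventSet hz, fun i f => (hG_eq i f z hz).symm⟩

theorem spectralBound_le (hT : T.HasGrowthBound M ω) : T.generator.spectralBound ≤ ω :=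
  _root_.spectralBound_le fun _ hz => hT.mem_resolventSet hz

end HasGrowthBound

open scoped ComplexOrder in
theorem exists_spectralBound_eq_mem_spectrum [CompleteSpace E] (T : C0Semigroup E) {ι : Type*}
    {ℓ : ι → E →L[ℂ] ℂ} (hsep : ∀ f, (∀ i, ℓ i f = 0) → f = 0) {C : Set E}
    (hC : Submodule.span ℂ C = ⊤) (hpos : ∀ i, ∀ f ∈ C, ∀ᶠ t in atTop, 0 ≤ ℓ i (T.op t f))
    (hess : T.generator.essentialSpectralBound < T.generator.spectralBound) :
    ∃ s : ℝ, T.generator.spectralBound = s ∧ (s : ℂ) ∈ T.generator.spectrum := by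
  obtain ⟨M, ω, hT⟩ := T.exists_hasGrowthBound
  obtain ⟨s, hs⟩ : ∃ s : ℝ, T.generator.spectralBound = s :=
    ⟨_, (EReal.coe_toReal (hT.spectralBound_le.trans_lt (EReal.coe_lt_top ω)).ne
      hess.ne_bot).symm⟩
  refine ⟨s, hs, fun hsρ => ?_⟩
  obtain ⟨c, hess_c, hcs, hray⟩ :=
    exists_lt_forall_ofReal_mem_resolventSet hs hsρ (hs ▸ hess)
  have hle : T.generator.spectralBound ≤ c :=
    spectralBound_le (hT.halfPlane_subset_resolventSet hess_c hray hsep hC hpos)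
  rw [hs, EReal.coe_le_coe_iff] at hle
  exact hle.not_gt hcs

end C0Semigroup

end Semigroup

section PositiveOperators

variable {X Y : Type*} [NormedAddCommGroup X] [NormedSpace ℝ X] [CompleteSpace X] [Lattice X]
  [IsOrderedAddMonoid X] [IsOrderedModule ℝ X] [HasSolidNorm X]
  [NormedAddCommGroup Y] [NormedSpace ℝ Y] [Lattice Y] [IsOrderedAddMonoid Y] [HasSolidNorm Y]

theorem exists_norm_map_le_of_map_nonneg (S : X →ₗ[ℝ] Y) (hS : ∀ x, 0 ≤ x → 0 ≤ S x) :
    ∃ C : ℝ, ∀ x, 0 ≤ x → ‖S x‖ ≤ C * ‖x‖ := by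
  by_contra! hunbounded
  choose x hx hxS using fun n : ℕ => hunbounded (4 ^ n)
  have hx_pos (n : ℕ) : 0 < ‖x n‖ := norm_pos_iff.2 fun h => by simpa [h] using hxS n
  -- The scaled vectors have norms `2⁻ⁿ` and images of norm at least `2ⁿ`; their sum dominates each.
  let y (n : ℕ) : X := (2 ^ n * ‖x n‖)⁻¹ • x n
  have hy (n : ℕ) : 0 ≤ y n := smul_nonneg (by positivity) (hx n)
  have hy_norm (n : ℕ) : ‖y n‖ = (1 / 2 : ℝ) ^ n := by
    have := hx_pos n
    rw [norm_smul, Real.norm_of_nonneg (by positivity), one_div, inv_pow]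
    field_simp
  have hyS (n : ℕ) : 2 ^ n ≤ ‖S (y n)‖ := by
    have := hx_pos n
    rw [map_smul, norm_smul, Real.norm_of_nonneg (by positivity), inv_mul_eq_div,
      le_div_iff₀ (by positivity), ← mul_assoc, ← mul_pow]
    norm_num [(hxS n).le]
  have hy_summable : Summable y :=
    .of_norm (by simpa only [hy_norm] using summable_geometric_two)
  have hSy_le (n : ℕ) : S (y n) ≤ S (∑' k, y k) := by
    have := hS _ (sub_nonneg.2 (hy_summable.le_tsum n fun k _ => hy k))
    rwa [map_sub, sub_nonneg] at this
  obtain ⟨n, hn⟩ := pow_unbounded_of_one_lt ‖S (∑' k, y k)‖ one_lt_two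
  exact (hn.trans_le (hyS n)).not_ge
    (Complexification.norm_le_norm_of_le (hS _ (hy n)) (hSy_le n))

theorem continuous_of_map_nonneg (S : X →ₗ[ℝ] Y) (hS : ∀ x, 0 ≤ x → 0 ≤ S x) :
    Continuous S := by
  obtain ⟨C, hC⟩ := exists_norm_map_le_of_map_nonneg S hS
  have hle (x : X) : ‖S |x|‖ ≤ C * ‖x‖ := by
    simpa only [norm_abs_eq_norm] using hC |x| (abs_nonneg x)
  refine AddMonoidHomClass.continuous_of_bound S C fun x => (?_ : _ ≤ ‖S |x|‖).trans (hle x)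
  refine norm_le_norm_of_abs_le_abs ((abs_le'.2 ⟨?_, ?_⟩).trans (le_abs_self _))
  · simpa using hS _ (sub_nonneg.2 (le_abs_self x))
  · simpa [neg_le_iff_add_nonneg] using hS _ (neg_le_iff_add_nonneg.1 (neg_le_abs x))

end PositiveOperators

section PositiveFunctionals

variable {X : Type*} [NormedAddCommGroup X] [NormedSpace ℝ X] [Lattice X]
  [IsOrderedAddMonoid X] [IsOrderedModule ℝ X] [HasSolidNorm X]

theorem exists_dual_nonneg_apply_neg {x : X} (hx : ¬0 ≤ x) :
    ∃ φ : StrongDual ℝ X, (∀ y, 0 ≤ y → 0 ≤ φ y) ∧ φ x < 0 := by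
  obtain ⟨φ, hφ, hφx⟩ :=
    (ProperCone.positive ℝ X).hyperplane_separation_point (x₀ := x) (by simpa using hx)
  exact ⟨φ, fun y hy => hφ y (by simpa using hy), hφx⟩

theorem eq_zero_of_forall_dual_nonneg {x : X}
    (h : ∀ φ : StrongDual ℝ X, (∀ y, 0 ≤ y → 0 ≤ φ y) → φ x = 0) : x = 0 := by
  have hnonneg (y : X) (hy : ∀ φ : StrongDual ℝ X, (∀ z, 0 ≤ z → 0 ≤ φ z) → φ y = 0) : 0 ≤ y := by
    by_contra hneg
    obtain ⟨φ, hφ, hφy⟩ := exists_dual_nonneg_apply_neg hneg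
    exact hφy.ne (hy φ hφ)
  exact le_antisymm (neg_nonneg.1 (hnonneg (-x) fun φ hφ => by simp [h φ hφ])) (hnonneg x h)

end PositiveFunctionals

namespace Complexification

section RealPart

variable {X : Type*} [AddCommGroup X] [Module ℝ X]

theorem mk_zero_add_I_smul (z : Complexification X) :
    (⟨z.re, 0⟩ : Complexification X) + Complex.I • ⟨z.im, 0⟩ = z := by
  ext <;> simp

/-- The compression `x ↦ Re (P (x + i 0))` of a complex-linear operator to the real space. -/
def compressRe (P : Complexification X →ₗ[ℂ] Complexification X) : X →ₗ[ℝ] X where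
  toFun x := (P ⟨x, 0⟩).re
  map_add' x y := by
    rw [← add_re, ← map_add]
    congr 2
    ext <;> simp
  map_smul' c x := by
    have hsmul : (⟨c • x, 0⟩ : Complexification X) = (c : ℂ) • ⟨x, 0⟩ := by
      ext <;> simp only [smul_re, smul_im, Complex.ofReal_re, Complex.ofReal_im, zero_smul,
        smul_zero, sub_zero, add_zero]
    rw [hsmul, map_smul, smul_re, Complex.ofReal_re, Complex.ofReal_im, zero_smul, sub_zero,
      RingHom.id_apply]

end RealPart

section PositiveCone

variable {X : Type*} [AddCommGroup X] [Lattice X]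

theorem mk_mem_positiveCone {x : X} (hx : 0 ≤ x) :
    (⟨x, 0⟩ : Complexification X) ∈ positiveCone X := ⟨hx, rfl⟩

variable [IsOrderedAddMonoid X]

theorem mk_posPart_sub_mk_negPart (x : X) :
    (⟨x⁺, 0⟩ - ⟨x⁻, 0⟩ : Complexification X) = ⟨x, 0⟩ := by
  ext <;> simp [posPart_sub_negPart]

variable [Module ℝ X]

theorem span_positiveCone : Submodule.span ℂ (positiveCone X) = ⊤ := by
  have hreal (x : X) : (⟨x, 0⟩ : Complexification X) ∈ Submodule.span ℂ (positiveCone X) := by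
    rw [← mk_posPart_sub_mk_negPart x]
    exact sub_mem (Submodule.subset_span (mk_mem_positiveCone (posPart_nonneg x)))
      (Submodule.subset_span (mk_mem_positiveCone (negPart_nonneg x)))
  refine eq_top_iff.2 fun z _ => ?_
  rw [← mk_zero_add_I_smul z]
  exact add_mem (hreal _) (Submodule.smul_mem _ _ (hreal _))

theorem IsPositiveOperator.apply_mk_zero {P : Complexification X →ₗ[ℂ] Complexification X}
    (hP : IsPositiveOperator P) (x : X) : P ⟨x, 0⟩ = ⟨compressRe P x, 0⟩ := by
  refine Complexification.ext rfl ?_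
  rw [← mk_posPart_sub_mk_negPart x, map_sub, sub_im,
    (hP _ (mk_mem_positiveCone (posPart_nonneg x))).2,
    (hP _ (mk_mem_positiveCone (negPart_nonneg x))).2, sub_zero]

end PositiveCone

variable {X : Type*} [NormedAddCommGroup X] [NormedSpace ℝ X] [CompleteSpace X] [Lattice X]
  [IsOrderedAddMonoid X] [IsOrderedModule ℝ X] [HasSolidNorm X]

theorem IsPositiveOperator.continuous {P : Complexification X →ₗ[ℂ] Complexification X}
    (hP : IsPositiveOperator P) : Continuous P := by
  let S : X →L[ℝ] X :=
    ⟨compressRe P, continuous_of_map_nonneg _ fun x hx => (hP _ (mk_mem_positiveCone hx)).1⟩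
  have hre (x : X) : ‖P ⟨x, 0⟩‖ ≤ ‖S‖ * ‖x‖ := by
    rw [hP.apply_mk_zero]
    calc ‖(⟨S x, 0⟩ : Complexification X)‖ ≤ ‖S x‖ + ‖(0 : X)‖ := norm_le_add _
      _ = ‖S x‖ := by rw [norm_zero, add_zero]
      _ ≤ ‖S‖ * ‖x‖ := S.le_opNorm x
  refine AddMonoidHomClass.continuous_of_bound P (2 * ‖S‖) fun z => ?_
  calc ‖P z‖ = ‖P ⟨z.re, 0⟩ + Complex.I • P ⟨z.im, 0⟩‖ := by
        rw [← map_smul, ← map_add, mk_zero_add_I_smul]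
    _ ≤ ‖P ⟨z.re, 0⟩‖ + ‖P ⟨z.im, 0⟩‖ :=
        (norm_add_le _ _).trans_eq (by rw [norm_smul, Complex.norm_I, one_mul])
    _ ≤ ‖S‖ * ‖z‖ + ‖S‖ * ‖z‖ := by
        gcongr
        · exact (hre _).trans (by gcongr; exact norm_re_le z)
        · exact (hre _).trans (by gcongr; exact norm_im_le z)
    _ = 2 * ‖S‖ * ‖z‖ := by ring

/-- The complex-linear extension `x + i y ↦ φ x + i φ y` of a real functional `φ`. -/
noncomputable def extendDual (φ : StrongDual ℝ X) : Complexification X →L[ℂ] ℂ :=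
  LinearMap.mkContinuous
    { toFun := fun z => (φ z.re : ℂ) + φ z.im * Complex.I
      map_add' := fun z w => by simp; ring
      map_smul' := fun c z => by apply Complex.ext <;> simp }
    (2 * ‖φ‖) fun z => by
      calc ‖(φ z.re : ℂ) + φ z.im * Complex.I‖ ≤ ‖φ z.re‖ + ‖φ z.im‖ :=
            (norm_add_le _ _).trans_eq (by simp)
        _ ≤ ‖φ‖ * ‖z‖ + ‖φ‖ * ‖z‖ := by
            gcongr
            · exact φ.le_opNorm_of_le (norm_re_le z)
            · exact φ.le_opNorm_of_le (norm_im_le z)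
        _ = 2 * ‖φ‖ * ‖z‖ := by ring

theorem extendDual_apply (φ : StrongDual ℝ X) (z : Complexification X) :
    extendDual φ z = (φ z.re : ℂ) + φ z.im * Complex.I := rfl

open scoped ComplexOrder in
theorem extendDual_nonneg {φ : StrongDual ℝ X} (hφ : ∀ y, 0 ≤ y → 0 ≤ φ y)
    {f : Complexification X} (hf : f ∈ positiveCone X) : 0 ≤ extendDual φ f := by
  simpa [extendDual_apply, hf.2] using hφ _ hf.1

theorem eq_zero_of_forall_extendDual_eq_zero {z : Complexification X}
    (h : ∀ φ : StrongDual ℝ X, (∀ y, 0 ≤ y → 0 ≤ φ y) → extendDual φ z = 0) : z = 0 :=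
  Complexification.ext
    (eq_zero_of_forall_dual_nonneg fun φ hφ => by
      simpa [extendDual_apply] using congrArg Complex.re (h φ hφ))
    (eq_zero_of_forall_dual_nonneg fun φ hφ => by
      simpa [extendDual_apply] using congrArg Complex.im (h φ hφ))

end Complexification

section LocalEventualPositivity

variable {X : Type*} [NormedAddCommGroup X] [NormedSpace ℝ X] [CompleteSpace X]
  [Lattice X] [IsOrderedAddMonoid X] [IsOrderedModule ℝ X] [HasSolidNorm X]
  {T : C0Semigroup (Complexification X)}

open Complexification (positiveCone extendDual)

theorem HasLEP.eq_zero_of_forall_apply_eq_zero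
    {P : ℕ → Complexification X →ₗ[ℂ] Complexification X} (hLEP : HasLEP T P)
    {f : Complexification X} (hf : ∀ n, P n f = 0) : f = 0 :=
  tendsto_nhds_unique (hLEP.tendsto_id f) (by simp only [hf, tendsto_const_nhds])

theorem HasLEP.eventually_mem_positiveCone
    {P : ℕ → Complexification X →ₗ[ℂ] Complexification X} (hLEP : HasLEP T P) (n : ℕ)
    {f : Complexification X} (hf : f ∈ positiveCone X) :
    ∀ᶠ t in atTop, P n (T.op t f) ∈ positiveCone X := by
  obtain rfl | hf₀ := eq_or_ne f 0
  · exact .of_forall fun t => by simpa only [map_zero] using hf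
  · obtain ⟨τ, -, hτ⟩ := hLEP.eventually_positive n f hf hf₀
    exact eventually_atTop.2 ⟨τ, hτ⟩

theorem mainTheorem3_general {ι : Type*} {P : ι → Complexification X →L[ℂ] Complexification X}
    (hsep : ∀ f, (∀ i, P i f = 0) → f = 0)
    (hpos : ∀ i, ∀ f ∈ positiveCone X, ∀ᶠ t in atTop, P i (T.op t f) ∈ positiveCone X)
    (hess : T.generator.essentialSpectralBound < T.generator.spectralBound) :
    ∃ s : ℝ, T.generator.spectralBound = (s : EReal) ∧ (s : ℂ) ∈ T.generator.spectrum := by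
  let ℓ (i : ι × {φ : StrongDual ℝ X // ∀ y, 0 ≤ y → 0 ≤ φ y}) : Complexification X →L[ℂ] ℂ :=
    (extendDual i.2.1).comp (P i.1)
  have hℓ_sep (f : Complexification X) (hf : ∀ i, ℓ i f = 0) : f = 0 :=
    hsep f fun i =>
      Complexification.eq_zero_of_forall_extendDual_eq_zero fun φ hφ => hf (i, ⟨φ, hφ⟩)
  refine T.exists_spectralBound_eq_mem_spectrum hℓ_sep Complexification.span_positiveCone
    (fun i f hf => ?_) hess
  exact (hpos i.1 f hf).mono fun t ht => Complexification.extendDual_nonneg i.2.2 ht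

end LocalEventualPositivity

theorem mainTheorem3 {X : Type*} [NormedAddCommGroup X] [NormedSpace ℝ X] [CompleteSpace X]
    [Lattice X] [IsOrderedAddMonoid X] [IsOrderedModule ℝ X] [HasSolidNorm X]
    (T : C0Semigroup (Complexification X))
    (P : ℕ → Complexification X →ₗ[ℂ] Complexification X)
    (hLEP : HasLEP T P)
    (hess : T.generator.essentialSpectralBound < T.generator.spectralBound) :
    ∃ s : ℝ, T.generator.spectralBound = (s : EReal) ∧ (s : ℂ) ∈ T.generator.spectrum :=
  mainTheorem3_general (P := fun n => ⟨P n, (hLEP.positive n).continuous⟩)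
    (fun _ hf => hLEP.eq_zero_of_forall_apply_eq_zero hf)
    (fun n _ hf => hLEP.eventually_mem_positiveCone n hf) hess
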